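/- **Signature.** Fix a set of base types, a set of base values $b$ each with a base type, and a set of primitive operators $\mathfrak o$ each with a closed type $\Sigma(\mathfrak o)$ of kind $\mathsf{Atom}$. **Explicit Remora.** Sorts are $\gamma ::= \mathsf{Dim}\mid\mathsf{Shape}$, kinds $k ::= \mathsf{Atom}\mid\mathsf{Array}$. Below, "…" after a phrase means a finite, possibly empty list of such phrases; terms are identified up to renaming of bound variables, and substitution avoids capture. - *Indices* $\iota ::= x \mid n \mid (\mathsf{Shp}\ \iota…)\mid(+\ \iota…)\mid(\mathbin{++}\ \iota…)$ with $n\in\mathbb N$. Naturals, and sums of dimensions, have sort $\mathsf{Dim}$; $\mathsf{Shp}$ of dimensions, and $\mathbin{++}$ (concatenation) of shapes, have sort $\mathsf{Shape}$. Indices of the same sort are equivalent, $\iota\equiv\iota'$, if they denote the same number (or the same sequence of numbers) under all well-sorted interpretations of their variables. $\iota\sqsubseteq\iota'$ (prefix order) means that $(\mathbin{++}\ \iota\ \iota'')\equiv\iota'$ for some shape $\iota''$. - *Types* $\tau ::= x\mid B\mid(\to(\tau…)\ \tau)\mid(\forall((x\,k)…)\ \tau)\mid(\Pi((x\,\gamma)…)\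 \tau)\mid(\Sigma((x\,\gamma)…)\ \tau)\mid(\mathsf{Arr}\ \tau\ \iota)$ with $B$ a base type. $(\mathsf{Arr}\ \tau\ \iota)$ has kind $\mathsf{Array}$ if $\tau$ has kind $\mathsf{Atom}$ and $\iota$ sort $\mathsf{Shape}$; base, function, universal, product and sum types have kind $\mathsf{Atom}$ if all the types that they are built from have kind $\mathsf{Array}$. Type equivalence $\equiv$ is the congruence generated by equivalence of the shapes of array types. - *Terms* carry type tags, written as superscripts: expressions $e ::= x\mid(\mathsf{array}\ (n…)\ a…)^\tau\mid(\mathsf{frame}\ (n…)\ e…)^\tau\mid(e^{(\mathsf{Arr}\,(\to(\tau…)\,\tau')\,\iota)}\ e…)^\tau\mid(\mathsf{t\text{-}app}\ e\ \tau…)^\tau\mid(\mathsf{i\text{-}app}\ e\ \iota…)^\tau\mid(\mathsf{unbox}\ (x…\ x_e\ e)\ e^\tau)$, and atoms $a ::= b\mid\mathfrak o\mid(\lambda((x\ \tau)…)\ e)\mid(T\lambda((x\ k)…)\ e)\mid(I\lambda((x\ \gamma)…)\ e)\mid(\mathsf{box}\ \iota…\ e\ \tau)$. The tag of the body of an unboxing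 does not use the index variables which the unboxing binds. - *Values* $v$ are the array literals all of whose atoms are atomic values $\mathfrak v$; all atoms are atomic values, except that $(\mathsf{box}\ \iota…\ e\ \tau)$ is one only if $e$ is a value. *Typing.* Types of expressions and atoms may be replaced by equivalent types, and every tag must be equivalent to the type which the respective rule assigns. Variables have the type given by the environment; $b$ and $\mathfrak o$ have their given types; abstractions have function types (with parameter types of kind $\mathsf{Array}$), universal types, and product types in the usual way. - $(\mathsf{array}\ (n…)\ a…) : (\mathsf{Arr}\ \tau\ (\mathsf{Shp}\ n…))$ if there are $\prod n$ atoms, all of type $\tau:\mathsf{Atom}$. - $(\mathsf{frame}\ (n…)\ e…):(\mathsf{Arr}\ \tau\ (\mathbin{++}\,(\mathsf{Shp}\ n…)\ \iota))$ if there are $\prod n$ cells $e$, all of type $(\mathsf{Arr}\ \tau\ \iota):\mathsf{Array}$. - $(e_f\ e_a…):(\mathsf{Arr}\ \tau_o\ (\mathbin{++}\ \iota_p\ \iota_o))$ if $e_f:(\mathsf{Arr}\ (\to((\mathsf{Arr}\ \tau_i\ \iota_i)…)\ (\mathsf{Arr}\ \tau_o\ \iota_o))\ \iota_f)$, each $e_a:(\mathsf{Arr}\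 \tau_i\ (\mathbin{++}\ \iota_a\ \iota_i))$, and the principal frame $\iota_p$ is the greatest of $\iota_f,\iota_a…$ for $\sqsubseteq$. The function position is tagged with the type of $e_f$. - $(\mathsf{t\text{-}app}\ e\ \tau_a…):(\mathsf{Arr}\ \tau[\tau_a/x,…]\ (\mathbin{++}\ \iota_f\ \iota))$ if $e:(\mathsf{Arr}\ (\forall((x\,k)…)(\mathsf{Arr}\ \tau\ \iota))\ \iota_f)$ and $\tau_a:k$ for each position; likewise for $\mathsf{i\text{-}app}$ and $\Pi$, where indices are substituted both in $\tau$ and in $\iota$. - $(\mathsf{box}\ \iota…\ e\ \tau):\tau$ if $\tau=(\Sigma((x\,\gamma)…)\ \tau')$ is well-kinded, $\iota:\gamma$ for each position, and $e:\tau'[\iota/x,…]$. - $(\mathsf{unbox}\ (x…\ x_e\ e)\ e_b):(\mathsf{Arr}\ \tau_b\ (\mathbin{++}\ \iota_s\ \iota_b))$ if $e:(\mathsf{Arr}\ (\Sigma((x\,\gamma)…)\ \tau_s)\ \iota_s)$ and $e_b:(\mathsf{Arr}\ \tau_b\ \iota_b)$ in the environment extended by $x:\gamma,…$ and $x_e:\tau_s$,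 where $(\mathsf{Arr}\ \tau_b\ \iota_b)$ is well-kinded without the variables $x$; the tag of the body is equivalent to $(\mathsf{Arr}\ \tau_b\ \iota_b)$. *Evaluation.* $e\mapsto e'$ is the contraction of a redex in an evaluation context. Evaluation contexts reduce, from left to right, the contents of boxes in an array literal, the cells of a frame, the function and then the arguments of an application, the first subterm of a type or index application, and the boxed argument of an unboxing. Redexes are the following, where literal shapes are compared with indices by evaluating the (closed) indices. In an application of an array value of functions with frame $(n_f…)$ to array values, the shape of each argument splits uniquely as an argument frame $(n_a…)$ followed by the cell shape $(n_i…)$ that the function tag gives. - *lift*: if the frames $(n_f…),(n_a…),…$ have a greatest element $(n_p…)$ for the prefix order, but are not all equal to it, the cells of the function and argument arrays are replicated so that all have frame $(n_p…)$; the tags are adapted, and the result tag is kept. - *map*: if all frames are equal to $(n_f…)$, which is not empty, and the result tag is $(\mathsf{Arr}\ \tau\ \iota)$ with $\iota\equiv(\mathsf{Shp}\ n_f…\ n_o…)$: the contractum is the frame of shape $(n_f…)$, with this tag, whose $j$-th cell is the application of the $j$-th function to the $j$-th cells of the arguments, with result tag $(\mathsf{Arr}\ \tau\ (\mathsf{Shp}\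 n_o…))$. - $\beta$ and $\delta$: if all frames are empty and the function is a $\lambda$-abstraction with the right number of parameters, the arguments are substituted in its body; if it is an operator $\mathfrak o$ and $\delta(\mathfrak o)$ is defined on the arguments, the contractum is the value of $\delta(\mathfrak o)$. - $t\beta$, $i\beta$: the type (index) application, with tag $\tau$, of an array with shape $(n…)$ of type (index) abstractions becomes the frame $(n…)$, with tag $\tau$, of the instantiated bodies. - *unbox*: $(\mathsf{unbox}\ (x…\ x_e\ (\mathsf{array}\ (n…)\ (\mathsf{box}\ \iota_s…\ v_s\ \tau_s)…))\ e_b^{(\mathsf{Arr}\,\tau\,\iota)})\mapsto(\mathsf{frame}\ (n…)\ e_b[\iota_s/x,…,v_s/x_e]…)$ with tag $(\mathsf{Arr}\ \tau\ (\mathbin{++}\ (\mathsf{Shp}\ n…)\ \iota))$. - *collapse*: a frame of shape $(n…)$ with tag $(\mathsf{Arr}\ \tau\ \iota)$ whose cells are values of the same shape $(n_c…)$, where $\iota\equiv(\mathsf{Shp}\ n…\ n_c…)$, becomes the array literal with this tag, with shape $(n…\ n_c…)$, and with the concatenated atoms. **Erased Remora** has expressions $x$, $(\mathsf{array}\ (n…)\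 a…)$, $(\mathsf{frame}\ \iota\ e…)$, $(e\ (e\ \iota)…\ \iota')$, $(\mathsf{i\text{-}app}\ e\ \iota…\ \iota')$, $(\mathsf{unbox}\ (x…\ x_e\ e)\ e\ \iota)$ and atoms $b$, $\mathfrak o$, $(\lambda(x…)\ e)$, $(I\lambda(x…)\ e)$, $(\mathsf{box}\ \iota…\ e)$. A frame carries its result shape, an application the cell shape of each argument and the result shape, an index application its result shape, an unboxing the shape of its body. Erased values $\hat v$ and the step relation $\mapsto$ are defined by the same evaluation contexts and the same rules, reading these shapes in place of the tags; there are no type abstractions and applications and there is no $t\beta$ rule, and operators are interpreted by $\hat\delta$ in place of $\delta$. **Erasure.** $\mathrm{erase}(\mathsf{Arr}\ \tau\ \iota)=\iota$; a type variable is erased to a corresponding index variable, and any other type to $(\mathsf{Shp})$. Erasure of terms is compositional: it drops the tags of array literals, the parameter types, sorts and kinds, and the type of a box; a frame, a type or index application and the body of an unboxing keep the erasure of their tags; an application keeps the erasures of the input types in its function tag and of its result tag; type abstractions, and type applications to $\tau…$, become index abstractions, and index applications to $\mathrm{erase}(\tau)…$. **Operators.** For every $\mathfrak o$, $\delta(\mathfrak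 o)$ and $\hat\delta(\mathfrak o)$ are partial functions on lists of explicit and of erased terms. They agree: if $\Sigma(\mathfrak o)=(\to(\tau_1\dots\tau_m)\ \tau)$ and $v_1,\dots,v_m$ are closed values of types $\tau_1,\dots,\tau_m$, then $\hat\delta(\mathfrak o)$ is defined on $\mathrm{erase}(v_1),\dots,\mathrm{erase}(v_m)$ if and only if $\delta(\mathfrak o)$ is defined on $v_1,\dots,v_m$, and then its value there is the erasure of the value of $\delta(\mathfrak o)$. A term is *stuck* if it is not a value (of its language) and takes no step. **Lemma (Lockstep).** For every closed well-typed explicit expression $e$, at least one of the following holds: 1. $e$ is a value and $\mathrm{erase}(e)$ is an erased value; 2. there is an $e'$ with $e\mapsto e'$ and $\mathrm{erase}(e)\mapsto\mathrm{erase}(e')$; 3. $e$ and $\mathrm{erase}(e)$ are both stuck. -/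

import Mathlib

universe u

namespace Remora

/-! ## Type indices

All binders are represented by de Bruijn indices, separately for index variables, type variables and
term variables.  A binder may bind several variables at once: below a binder of `n` variables, the
number `k < n` is the `k`-th variable of that binder, and `k ≥ n` is the outer variable `k - n`. -/

/-- Sorts of indices. -/
inductive Srt
  | dim
  | shape

/-- Type indices: variables, naturals, `(Shp ι ...)`, `(+ ι ...)` and `(++ ι ...)`. -/
inductive Idx
  | var (k : ℕ)
  | nat (n : ℕ)
  | shp (ιs : List Idx)
  | plus (ιs : List Idx)
  | append (ιs : List Idx)

/-- The index `(Shp n ...)` of a list of literal dimensions. -/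
def Idx.lits (ns : List ℕ) : Idx := .shp (ns.map Idx.nat)

/-- Lift a renaming below a binder of `n` variables. -/
def liftR (n : ℕ) (ρ : ℕ → ℕ) (k : ℕ) : ℕ := if k < n then k else ρ (k - n) + n

mutual
def Idx.rename (ρ : ℕ → ℕ) : Idx → Idx
  | .var k => .var (ρ k)
  | .nat n => .nat n
  | .shp ιs => .shp (Idx.renames ρ ιs)
  | .plus ιs => .plus (Idx.renames ρ ιs)
  | .append ιs => .append (Idx.renames ρ ιs)
def Idx.renames (ρ : ℕ → ℕ) : List Idx → List Idx
  | [] => []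
  | ι :: ιs => ι.rename ρ :: Idx.renames ρ ιs
end

mutual
def Idx.subst (σ : ℕ → Idx) : Idx → Idx
  | .var k => σ k
  | .nat n => .nat n
  | .shp ιs => .shp (Idx.substs σ ιs)
  | .plus ιs => .plus (Idx.substs σ ιs)
  | .append ιs => .append (Idx.substs σ ιs)
def Idx.substs (σ : ℕ → Idx) : List Idx → List Idx
  | [] => []
  | ι :: ιs => ι.subst σ :: Idx.substs σ ιs
end

/-- Lift an index substitution below a binder of `n` index variables. -/
def liftI (n : ℕ) (σ : ℕ → Idx) (k : ℕ) : Idx :=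
  if k < n then .var k else (σ (k - n)).rename (· + n)

/-- The substitution that replaces the variables of the innermost binder by `ιs`. -/
def instI (ιs : List Idx) (k : ℕ) : Idx := (ιs[k]?).getD (.var (k - ιs.length))

/-- `HasSort Θ ι γ`: in the sort environment `Θ`, the index `ι` has sort `γ`. -/
inductive HasSort (Θ : List Srt) : Idx → Srt → Prop
  | var {k γ} : Θ[k]? = some γ → HasSort Θ (.var k) γ
  | nat {n} : HasSort Θ (.nat n) .dim
  | shp {ιs} : (∀ ι ∈ ιs, HasSort Θ ι .dim) → HasSort Θ (.shp ιs) .shape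
  | plus {ιs} : (∀ ι ∈ ιs, HasSort Θ ι .dim) → HasSort Θ (.plus ιs) .dim
  | append {ιs} : (∀ ι ∈ ιs, HasSort Θ ι .shape) → HasSort Θ (.append ιs) .shape

/-- The objects denoted by indices: natural numbers and finite sequences of natural numbers. -/
inductive IVal
  | dim (n : ℕ)
  | shape (ns : List ℕ)

def IVal.srt : IVal → Srt
  | .dim _ => .dim
  | .shape _ => .shape

mutual
/-- The value of an index under an assignment of values to (some of) the variables; it is undefined
if the index is not well-sorted or uses a variable without a value. -/
def Idx.eval (ρ : ℕ → Option IVal) : Idx → Option IVal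
  | .var k => ρ k
  | .nat n => some (.dim n)
  | .shp ιs => (Idx.evalDims ρ ιs).map fun ns => .shape ns
  | .plus ιs => (Idx.evalDims ρ ιs).map fun ns => .dim ns.sum
  | .append ιs => (Idx.evalShapes ρ ιs).map fun nss => .shape nss.flatten
def Idx.evalDims (ρ : ℕ → Option IVal) : List Idx → Option (List ℕ)
  | [] => some []
  | ι :: ιs =>
    match ι.eval ρ, Idx.evalDims ρ ιs with
    | some (.dim n), some ns => some (n :: ns)
    | _, _ => none
def Idx.evalShapes (ρ : ℕ → Option IVal) : List Idx → Option (List (List ℕ))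
  | [] => some []
  | ι :: ιs =>
    match ι.eval ρ, Idx.evalShapes ρ ιs with
    | some (.shape ns), some nss => some (ns :: nss)
    | _, _ => none
end

/-- The sequence of dimensions denoted by a closed index of sort `Shape`. -/
def Idx.dims? (ι : Idx) : Option (List ℕ) :=
  match ι.eval (fun _ => none) with
  | some (.shape ns) => some ns
  | _ => none

/-- `IdxEqv Θ ι ι'`: the equation `ι ≡ ι'` between indices of the same sort is valid, that is, it holds
under every interpretation of the index variables that respects their sorts in `Θ`. -/
def IdxEqv (Θ : List Srt) (ι ι' : Idx) : Prop :=
  (∃ γ, HasSort Θ ι γ ∧ HasSort Θ ι' γ) ∧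
  ∀ ρ : ℕ → Option IVal, (∀ k γ, Θ[k]? = some γ → ∃ v, ρ k = some v ∧ v.srt = γ) →
    ι.eval ρ = ι'.eval ρ

/-- The prefix order on shapes. -/
def IdxPrefix (Θ : List Srt) (ι ι' : Idx) : Prop :=
  ∃ w, HasSort Θ w .shape ∧ IdxEqv Θ (.append [ι, w]) ι'

/-- `ιp` is the maximum of the shapes `ιs` in the prefix order. -/
def IsMaxIdx (Θ : List Srt) (ιs : List Idx) (ιp : Idx) : Prop :=
  ιp ∈ ιs ∧ ∀ ι ∈ ιs, IdxPrefix Θ ι ιp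

/-! ## Types -/

/-- Kinds of types. -/
inductive Knd
  | atom
  | array

/-- Types over a set `B` of base types: variables, base types, functions `(-> (τ ...) τ)`, universal
types, dependent products, dependent sums, and array types `(Arr τ ι)`. -/
inductive Ty (B : Type u)
  | var (k : ℕ)
  | base (b : B)
  | fn (ins : List (Ty B)) (out : Ty B)
  | univ (ks : List Knd) (body : Ty B)
  | pi (γs : List Srt) (body : Ty B)
  | sigma (γs : List Srt) (body : Ty B)
  | arr (elem : Ty B) (ι : Idx)

section Ty
variable {B : Type u}

mutual
/-- Rename index variables by `ρI` and type variables by `ρT`. -/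
def Ty.rename (ρI ρT : ℕ → ℕ) : Ty B → Ty B
  | .var k => .var (ρT k)
  | .base b => .base b
  | .fn ins out => .fn (Ty.renames ρI ρT ins) (out.rename ρI ρT)
  | .univ ks body => .univ ks (body.rename ρI (liftR ks.length ρT))
  | .pi γs body => .pi γs (body.rename (liftR γs.length ρI) ρT)
  | .sigma γs body => .sigma γs (body.rename (liftR γs.length ρI) ρT)
  | .arr elem ι => .arr (elem.rename ρI ρT) (ι.rename ρI)
def Ty.renames (ρI ρT : ℕ → ℕ) : List (Ty B) → List (Ty B)
  | [] => []
  | τ :: τs => τ.rename ρI ρT :: Ty.renames ρI ρT τs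
end

/-- Bring types into the scope of `n` more index variables. -/
def shiftTI (n : ℕ) (σ : ℕ → Ty B) (k : ℕ) : Ty B := (σ k).rename (· + n) id

/-- Lift a type substitution below a binder of `n` type variables. -/
def liftT (n : ℕ) (σ : ℕ → Ty B) (k : ℕ) : Ty B :=
  if k < n then .var k else (σ (k - n)).rename id (· + n)

/-- The substitution that replaces the variables of the innermost binder by `τs`. -/
def instT (τs : List (Ty B)) (k : ℕ) : Ty B := (τs[k]?).getD (.var (k - τs.length))

mutual
/-- Simultaneous capture-avoiding substitution of index and type variables. -/
def Ty.subst (σI : ℕ → Idx) (σT : ℕ → Ty B) : Ty B → Ty B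
  | .var k => σT k
  | .base b => .base b
  | .fn ins out => .fn (Ty.substs σI σT ins) (out.subst σI σT)
  | .univ ks body => .univ ks (body.subst σI (liftT ks.length σT))
  | .pi γs body => .pi γs (body.subst (liftI γs.length σI) (shiftTI γs.length σT))
  | .sigma γs body => .sigma γs (body.subst (liftI γs.length σI) (shiftTI γs.length σT))
  | .arr elem ι => .arr (elem.subst σI σT) (ι.subst σI)
def Ty.substs (σI : ℕ → Idx) (σT : ℕ → Ty B) : List (Ty B) → List (Ty B)
  | [] => []
  | τ :: τs => τ.subst σI σT :: Ty.substs σI σT τs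
end

/-- `HasKind Θ Δ τ k`: the type `τ` has kind `k`. -/
inductive HasKind : List Srt → List Knd → Ty B → Knd → Prop
  | var {Θ Δ j k} : Δ[j]? = some k → HasKind Θ Δ (.var j) k
  | base {Θ Δ b} : HasKind Θ Δ (.base b) .atom
  | fn {Θ Δ ins out} : (∀ τ ∈ ins, HasKind Θ Δ τ .array) → HasKind Θ Δ out .array →
      HasKind Θ Δ (.fn ins out) .atom
  | univ {Θ Δ ks body} : HasKind Θ (ks ++ Δ) body .array → HasKind Θ Δ (.univ ks body) .atom
  | pi {Θ Δ γs body} : HasKind (γs ++ Θ) Δ body .array → HasKind Θ Δ (.pi γs body) .atom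
  | sigma {Θ Δ γs body} : HasKind (γs ++ Θ) Δ body .array → HasKind Θ Δ (.sigma γs body) .atom
  | arr {Θ Δ elem ι} : HasKind Θ Δ elem .atom → HasSort Θ ι .shape →
      HasKind Θ Δ (.arr elem ι) .array

/-- Type equivalence: congruence up to validity of equations between array shapes. -/
inductive TEqv : List Srt → Ty B → Ty B → Prop
  | refl {Θ τ} : TEqv Θ τ τ
  | arr {Θ τ τ' ι ι'} : TEqv Θ τ τ' → IdxEqv Θ ι ι' → TEqv Θ (.arr τ ι) (.arr τ' ι')
  | fn {Θ ins ins' out out'} : ins.length = ins'.length →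
      (∀ p ∈ ins.zip ins', TEqv Θ p.1 p.2) → TEqv Θ out out' →
      TEqv Θ (.fn ins out) (.fn ins' out')
  | univ {Θ ks body body'} : TEqv Θ body body' → TEqv Θ (.univ ks body) (.univ ks body')
  | pi {Θ γs body body'} : TEqv (γs ++ Θ) body body' → TEqv Θ (.pi γs body) (.pi γs body')
  | sigma {Θ γs body body'} : TEqv (γs ++ Θ) body body' →
      TEqv Θ (.sigma γs body) (.sigma γs body')

end Ty

/-- The data left open by the language: base types, base values with their types, and primitive
operators with their (closed) types. -/
structure Sig where
  BaseTy : Type u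
  BaseVal : Type u
  Op : Type u
  valTy : BaseVal → BaseTy
  opTy : Op → Ty BaseTy
  opTy_kind : ∀ o, HasKind [] [] (opTy o) .atom

/-! ## Explicit terms

Terms carry the type tags which reduction and erasure consult.  An application
`app f ins out ι args τ` stands for `(f^(Arr (-> ins out) ι) args ...)^τ`; an unboxing
`unbox n e body τ` stands for `(unbox (x₀ ... xₙ₋₁ x e) body^τ)`. -/

mutual
inductive Expr (S : Sig.{u}) : Type u
  /-- term variable -/
  | var (x : ℕ)
  /-- array literal `(array (n ...) a ...)` with its type tag -/
  | arr (tag : Ty S.BaseTy) (ns : List ℕ) (atoms : List (Atom S))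
  /-- nested array `(frame (n ...) e ...)` with its type tag -/
  | frame (tag : Ty S.BaseTy) (ns : List ℕ) (cells : List (Expr S))
  /-- function application, with the type tags of its function position and of its result -/
  | app (f : Expr S) (ins : List (Ty S.BaseTy)) (out : Ty S.BaseTy) (ι : Idx)
      (args : List (Expr S)) (tag : Ty S.BaseTy)
  /-- type application `(t-app f τ ...)` with its type tag -/
  | tapp (f : Expr S) (τs : List (Ty S.BaseTy)) (tag : Ty S.BaseTy)
  /-- index application `(i-app f ι ...)` with its type tag -/
  | iapp (f : Expr S) (ιs : List Idx) (tag : Ty S.BaseTy)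
  /-- unboxing: the body is in the scope of `n` index variables and of one term variable, its type
  tag is not in the scope of these index variables -/
  | unbox (n : ℕ) (e : Expr S) (body : Expr S) (bodyTag : Ty S.BaseTy)
inductive Atom (S : Sig.{u}) : Type u
  | base (b : S.BaseVal)
  | op (o : S.Op)
  /-- `(λ ((x τ) ...) e)` -/
  | lam (τs : List (Ty S.BaseTy)) (body : Expr S)
  /-- `(Tλ ((x k) ...) e)` -/
  | tlam (ks : List Knd) (body : Expr S)
  /-- `(Iλ ((x γ) ...) e)` -/
  | ilam (γs : List Srt) (body : Expr S)
  /-- `(box ι ... e τ)` -/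
  | box (ιs : List Idx) (e : Expr S) (τ : Ty S.BaseTy)
end

section Explicit
variable {S : Sig.{u}}

mutual
/-- Rename index, type and term variables. -/
def Expr.rename (ρI ρT ρE : ℕ → ℕ) : Expr S → Expr S
  | .var x => .var (ρE x)
  | .arr tag ns atoms => .arr (tag.rename ρI ρT) ns (Atom.renames ρI ρT ρE atoms)
  | .frame tag ns cells => .frame (tag.rename ρI ρT) ns (Expr.renames ρI ρT ρE cells)
  | .app f ins out ι args tag =>
      .app (f.rename ρI ρT ρE) (Ty.renames ρI ρT ins) (out.rename ρI ρT) (ι.rename ρI)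
        (Expr.renames ρI ρT ρE args) (tag.rename ρI ρT)
  | .tapp f τs tag => .tapp (f.rename ρI ρT ρE) (Ty.renames ρI ρT τs) (tag.rename ρI ρT)
  | .iapp f ιs tag => .iapp (f.rename ρI ρT ρE) (Idx.renames ρI ιs) (tag.rename ρI ρT)
  | .unbox n e body bodyTag =>
      .unbox n (e.rename ρI ρT ρE) (body.rename (liftR n ρI) ρT (liftR 1 ρE))
        (bodyTag.rename ρI ρT)
def Atom.rename (ρI ρT ρE : ℕ → ℕ) : Atom S → Atom S
  | .base b => .base b
  | .op o => .op o
  | .lam τs body => .lam (Ty.renames ρI ρT τs) (body.rename ρI ρT (liftR τs.length ρE))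
  | .tlam ks body => .tlam ks (body.rename ρI (liftR ks.length ρT) ρE)
  | .ilam γs body => .ilam γs (body.rename (liftR γs.length ρI) ρT ρE)
  | .box ιs e τ => .box (Idx.renames ρI ιs) (e.rename ρI ρT ρE) (τ.rename ρI ρT)
def Expr.renames (ρI ρT ρE : ℕ → ℕ) : List (Expr S) → List (Expr S)
  | [] => []
  | e :: es => e.rename ρI ρT ρE :: Expr.renames ρI ρT ρE es
def Atom.renames (ρI ρT ρE : ℕ → ℕ) : List (Atom S) → List (Atom S)
  | [] => []
  | a :: as => a.rename ρI ρT ρE :: Atom.renames ρI ρT ρE as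
end

/-- Bring expressions into the scope of `n` more index variables. -/
def shiftEI (n : ℕ) (σ : ℕ → Expr S) (k : ℕ) : Expr S := (σ k).rename (· + n) id id

/-- Bring expressions into the scope of `n` more type variables. -/
def shiftET (n : ℕ) (σ : ℕ → Expr S) (k : ℕ) : Expr S := (σ k).rename id (· + n) id

/-- Lift a term substitution below a binder of `n` term variables. -/
def liftE (n : ℕ) (σ : ℕ → Expr S) (k : ℕ) : Expr S :=
  if k < n then .var k else (σ (k - n)).rename id id (· + n)

/-- The substitution that replaces the variables of the innermost binder by `es`. -/
def instE (es : List (Expr S)) (k : ℕ) : Expr S := (es[k]?).getD (.var (k - es.length))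

mutual
/-- Simultaneous capture-avoiding substitution of index, type and term variables; it also acts on all
type tags. -/
def Expr.subst (σI : ℕ → Idx) (σT : ℕ → Ty S.BaseTy) (σE : ℕ → Expr S) : Expr S → Expr S
  | .var x => σE x
  | .arr tag ns atoms => .arr (tag.subst σI σT) ns (Atom.substs σI σT σE atoms)
  | .frame tag ns cells => .frame (tag.subst σI σT) ns (Expr.substs σI σT σE cells)
  | .app f ins out ι args tag =>
      .app (f.subst σI σT σE) (Ty.substs σI σT ins) (out.subst σI σT) (ι.subst σI)
        (Expr.substs σI σT σE args) (tag.subst σI σT)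
  | .tapp f τs tag => .tapp (f.subst σI σT σE) (Ty.substs σI σT τs) (tag.subst σI σT)
  | .iapp f ιs tag => .iapp (f.subst σI σT σE) (Idx.substs σI ιs) (tag.subst σI σT)
  | .unbox n e body bodyTag =>
      .unbox n (e.subst σI σT σE)
        (body.subst (liftI n σI) (shiftTI n σT) (liftE 1 (shiftEI n σE)))
        (bodyTag.subst σI σT)
def Atom.subst (σI : ℕ → Idx) (σT : ℕ → Ty S.BaseTy) (σE : ℕ → Expr S) : Atom S → Atom S
  | .base b => .base b
  | .op o => .op o
  | .lam τs body => .lam (Ty.substs σI σT τs) (body.subst σI σT (liftE τs.length σE))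
  | .tlam ks body => .tlam ks (body.subst σI (liftT ks.length σT) (shiftET ks.length σE))
  | .ilam γs body =>
      .ilam γs (body.subst (liftI γs.length σI) (shiftTI γs.length σT) (shiftEI γs.length σE))
  | .box ιs e τ => .box (Idx.substs σI ιs) (e.subst σI σT σE) (τ.subst σI σT)
def Expr.substs (σI : ℕ → Idx) (σT : ℕ → Ty S.BaseTy) (σE : ℕ → Expr S) :
    List (Expr S) → List (Expr S)
  | [] => []
  | e :: es => e.subst σI σT σE :: Expr.substs σI σT σE es
def Atom.substs (σI : ℕ → Idx) (σT : ℕ → Ty S.BaseTy) (σE : ℕ → Expr S) :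
    List (Atom S) → List (Atom S)
  | [] => []
  | a :: as => a.subst σI σT σE :: Atom.substs σI σT σE as
end

/-- One argument position of a typed application: the element type and cell shape required by the
function, and the frame of the actual argument. -/
structure Param (B : Type u) where
  elem : Ty B
  cell : Idx
  frame : Idx

/-- The input type of the function at this position. -/
def Param.inTy {B : Type u} (p : Param B) : Ty B := .arr p.elem p.cell

/-- The type of the actual argument at this position. -/
def Param.argTy {B : Type u} (p : Param B) : Ty B := .arr p.elem (.append [p.frame, p.cell])

mutual
/-- `HasTy Θ Δ Γ e τ`: the expression `e` has type `τ`.  The tags in `e` must be correct, up to type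
equivalence. -/
inductive HasTy : List Srt → List Knd → List (Ty S.BaseTy) → Expr S → Ty S.BaseTy → Prop
  | eqv {Θ Δ Γ e τ τ'} : HasTy Θ Δ Γ e τ' → TEqv Θ τ τ' → HasTy Θ Δ Γ e τ
  | var {Θ Δ Γ x τ} : Γ[x]? = some τ → HasTy Θ Δ Γ (.var x) τ
  | arr {Θ Δ Γ tag ns atoms τ} :
      (∀ a ∈ atoms, AtomTy Θ Δ Γ a τ) → HasKind Θ Δ τ .atom → atoms.length = ns.prod →
      TEqv Θ tag (.arr τ (Idx.lits ns)) →
      HasTy Θ Δ Γ (.arr tag ns atoms) (.arr τ (Idx.lits ns))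
  | frame {Θ Δ Γ tag ns cells τ ι} :
      (∀ e ∈ cells, HasTy Θ Δ Γ e (.arr τ ι)) → HasKind Θ Δ (.arr τ ι) .array →
      cells.length = ns.prod →
      TEqv Θ tag (.arr τ (.append [Idx.lits ns, ι])) →
      HasTy Θ Δ Γ (.frame tag ns cells) (.arr τ (.append [Idx.lits ns, ι]))
  | app {Θ Δ Γ f args tag τo ιo ιf ιp} {ps : List (Param S.BaseTy)} :
      HasTy Θ Δ Γ f (.arr (.fn (ps.map Param.inTy) (.arr τo ιo)) ιf) →
      args.length = ps.length →
      (∀ q ∈ args.zip ps, HasTy Θ Δ Γ q.1 q.2.argTy) →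
      IsMaxIdx Θ (ιf :: ps.map Param.frame) ιp →
      TEqv Θ tag (.arr τo (.append [ιp, ιo])) →
      HasTy Θ Δ Γ (.app f (ps.map Param.inTy) (.arr τo ιo) ιf args tag)
        (.arr τo (.append [ιp, ιo]))
  | tapp {Θ Δ Γ f τs tag ks τ ι ιf} :
      HasTy Θ Δ Γ f (.arr (.univ ks (.arr τ ι)) ιf) →
      List.Forall₂ (HasKind Θ Δ) τs ks →
      TEqv Θ tag (.arr (τ.subst Idx.var (instT τs)) (.append [ιf, ι])) →
      HasTy Θ Δ Γ (.tapp f τs tag) (.arr (τ.subst Idx.var (instT τs)) (.append [ιf, ι]))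
  | iapp {Θ Δ Γ f ιs tag γs τ ι ιf} :
      HasTy Θ Δ Γ f (.arr (.pi γs (.arr τ ι)) ιf) →
      List.Forall₂ (HasSort Θ) ιs γs →
      TEqv Θ tag (.arr (τ.subst (instI ιs) Ty.var) (.append [ιf, ι.subst (instI ιs)])) →
      HasTy Θ Δ Γ (.iapp f ιs tag)
        (.arr (τ.subst (instI ιs) Ty.var) (.append [ιf, ι.subst (instI ιs)]))
  | unbox {Θ Δ Γ e body bodyTag γs τs ιs τ ι} :
      HasTy Θ Δ Γ e (.arr (.sigma γs τs) ιs) →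
      HasTy (γs ++ Θ) Δ (τs :: Γ.map (Ty.rename (· + γs.length) id)) body
        ((Ty.arr τ ι).rename (· + γs.length) id) →
      HasKind Θ Δ (.arr τ ι) .array →
      TEqv Θ bodyTag (.arr τ ι) →
      HasTy Θ Δ Γ (.unbox γs.length e body bodyTag) (.arr τ (.append [ιs, ι]))
/-- `AtomTy Θ Δ Γ a τ`: the atom `a` has type `τ`. -/
inductive AtomTy : List Srt → List Knd → List (Ty S.BaseTy) → Atom S → Ty S.BaseTy → Prop
  | eqv {Θ Δ Γ a τ τ'} : AtomTy Θ Δ Γ a τ' → TEqv Θ τ τ' → AtomTy Θ Δ Γ a τ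
  | base {Θ Δ Γ b} : AtomTy Θ Δ Γ (.base b) (.base (S.valTy b))
  | op {Θ Δ Γ o} : AtomTy Θ Δ Γ (.op o) (S.opTy o)
  | lam {Θ Δ Γ τs body τ} :
      HasTy Θ Δ (τs ++ Γ) body τ → (∀ τ' ∈ τs, HasKind Θ Δ τ' .array) →
      AtomTy Θ Δ Γ (.lam τs body) (.fn τs τ)
  | tlam {Θ Δ Γ ks body τ} :
      HasTy Θ (ks ++ Δ) (Γ.map (Ty.rename id (· + ks.length))) body τ →
      AtomTy Θ Δ Γ (.tlam ks body) (.univ ks τ)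
  | ilam {Θ Δ Γ γs body τ} :
      HasTy (γs ++ Θ) Δ (Γ.map (Ty.rename (· + γs.length) id)) body τ →
      AtomTy Θ Δ Γ (.ilam γs body) (.pi γs τ)
  | box {Θ Δ Γ ιs e γs τ} :
      List.Forall₂ (HasSort Θ) ιs γs → HasKind Θ Δ (.sigma γs τ) .atom →
      HasTy Θ Δ Γ e (τ.subst (instI ιs) Ty.var) →
      AtomTy Θ Δ Γ (.box ιs e (.sigma γs τ)) (.sigma γs τ)
end

mutual
/-- Values `v`: array literals all of whose atoms are atomic values. -/
inductive IsVal : Expr S → Prop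
  | arr {tag ns atoms} : (∀ a ∈ atoms, IsAVal a) → IsVal (.arr tag ns atoms)
/-- Atomic values: all atoms except boxes with unevaluated contents. -/
inductive IsAVal : Atom S → Prop
  | base {b} : IsAVal (.base b)
  | op {o} : IsAVal (.op o)
  | lam {τs body} : IsAVal (.lam τs body)
  | tlam {ks body} : IsAVal (.tlam ks body)
  | ilam {γs body} : IsAVal (.ilam γs body)
  | box {ιs e τ} : IsVal e → IsAVal (.box ιs e τ)
end

end Explicit

/-! ## List functions used by the reduction rules -/

/-- The `j`-th of the consecutive pieces of length `n` of a list. -/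
def piece {α : Type u} (n : ℕ) (l : List α) (j : ℕ) : List α := (l.drop (j * n)).take n

/-- The first `m` consecutive pieces of length `n` of a list.  (The number of pieces is given because
the length does not determine it if `n = 0`.) -/
def split {α : Type u} (m n : ℕ) (l : List α) : List (List α) := (List.range m).map (piece n l)

/-- Repeat each element of a list `n` times. -/
def rep {α : Type u} (n : ℕ) (l : List α) : List α := l.flatMap (List.replicate n)

/-- Replicate the cells of an array: `old` is its frame, `new` an extension of this frame, `n` the
number of atoms in a cell. -/
def replicateCells {α : Type u} (old new : List ℕ) (n : ℕ) (atoms : List α) : List α :=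
  (rep (new.drop old.length).prod (split old.prod n atoms)).flatten

/-- `np` is the maximum of the frames `fs` in the prefix order. -/
def IsMaxFrame (fs : List (List ℕ)) (np : List ℕ) : Prop := np ∈ fs ∧ ∀ f ∈ fs, f <+: np

/-! ## Reduction of explicit terms -/

section ExplicitStep
variable {S : Sig.{u}}

/-- An array literal in argument position whose shape is a frame followed by the cell shape that the
function's type tag `(Arr elem ι)` prescribes for this position. -/
structure ArgLit (S : Sig.{u}) where
  elem : Ty S.BaseTy
  ι : Idx
  tag : Ty S.BaseTy
  frame : List ℕ
  cell : List ℕ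
  atoms : List (Atom S)

def ArgLit.inTy (a : ArgLit S) : Ty S.BaseTy := .arr a.elem a.ι

def ArgLit.toExpr (a : ArgLit S) : Expr S := .arr a.tag (a.frame ++ a.cell) a.atoms

/-- The atoms are values, and `ι` denotes the cell shape. -/
def ArgLit.Ok (a : ArgLit S) : Prop := a.ι.dims? = some a.cell ∧ ∀ x ∈ a.atoms, IsAVal x

/-- The argument with its cells replicated so that its frame is `np`. -/
def ArgLit.lifted (np : List ℕ) (a : ArgLit S) : Expr S :=
  .arr (.arr a.elem (Idx.lits (np ++ a.cell))) (np ++ a.cell)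
    (replicateCells a.frame np a.cell.prod a.atoms)

/-- The `j`-th cell of the argument. -/
def ArgLit.nthCell (j : ℕ) (a : ArgLit S) : Expr S :=
  .arr (.arr a.elem (Idx.lits a.cell)) a.cell (piece a.cell.prod a.atoms j)

/-- Contraction of a redex.  `δ` interprets the primitive operators as partial functions. -/
inductive Red (δ : S.Op → List (Expr S) → Option (Expr S)) : Expr S → Expr S → Prop
  | lift {ftag nf fs out ι tag np} {as : List (ArgLit S)} :
      (∀ x ∈ fs, IsAVal x) → (∀ a ∈ as, a.Ok) →
      IsMaxFrame (nf :: as.map ArgLit.frame) np →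
      (∃ d ∈ nf :: as.map ArgLit.frame, d ≠ np) →
      Red δ
        (.app (.arr ftag nf fs) (as.map ArgLit.inTy) out ι (as.map ArgLit.toExpr) tag)
        (.app
          (.arr (.arr (.fn (as.map ArgLit.inTy) out) (Idx.lits np)) np (replicateCells nf np 1 fs))
          (as.map ArgLit.inTy) out (Idx.lits np) (as.map (ArgLit.lifted np)) tag)
  | map {ftag nf fs out ι τ ιr no} {as : List (ArgLit S)} :
      (∀ x ∈ fs, IsAVal x) → (∀ a ∈ as, a.Ok) →
      nf ≠ [] → (∀ a ∈ as, a.frame = nf) → ιr.dims? = some (nf ++ no) →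
      Red δ
        (.app (.arr ftag nf fs) (as.map ArgLit.inTy) out ι (as.map ArgLit.toExpr) (.arr τ ιr))
        (.frame (.arr τ ιr) nf (fs.mapIdx fun j f =>
          .app (.arr (.arr (.fn (as.map ArgLit.inTy) out) (Idx.lits [])) [] [f])
            (as.map ArgLit.inTy) out (Idx.lits []) (as.map (ArgLit.nthCell j))
            (.arr τ (Idx.lits no))))
  | beta {ftag τs body out ι tag} {as : List (ArgLit S)} :
      (∀ a ∈ as, a.Ok ∧ a.frame = []) → τs.length = as.length →
      Red δ
        (.app (.arr ftag [] [.lam τs body]) (as.map ArgLit.inTy) out ι (as.map ArgLit.toExpr) tag)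
        (body.subst Idx.var Ty.var (instE (as.map ArgLit.toExpr)))
  | delta {ftag o out ι tag v} {as : List (ArgLit S)} :
      (∀ a ∈ as, a.Ok ∧ a.frame = []) → δ o (as.map ArgLit.toExpr) = some v →
      Red δ
        (.app (.arr ftag [] [.op o]) (as.map ArgLit.inTy) out ι (as.map ArgLit.toExpr) tag) v
  | tbeta {ftag ns τs tag} {bs : List (List Knd × Expr S)} :
      (∀ b ∈ bs, b.1.length = τs.length) →
      Red δ
        (.tapp (.arr ftag ns (bs.map fun b => .tlam b.1 b.2)) τs tag)
        (.frame tag ns (bs.map fun b => b.2.subst Idx.var (instT τs) Expr.var))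
  | ibeta {ftag ns ιs tag} {bs : List (List Srt × Expr S)} :
      (∀ b ∈ bs, b.1.length = ιs.length) →
      Red δ
        (.iapp (.arr ftag ns (bs.map fun b => .ilam b.1 b.2)) ιs tag)
        (.frame tag ns (bs.map fun b => b.2.subst (instI ιs) Ty.var Expr.var))
  | unbox {n btag ns body τ ι} {bs : List (List Idx × Expr S × Ty S.BaseTy)} :
      (∀ b ∈ bs, b.1.length = n ∧ IsVal b.2.1) →
      Red δ
        (.unbox n (.arr btag ns (bs.map fun b => .box b.1 b.2.1 b.2.2)) body (.arr τ ι))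
        (.frame (.arr τ (.append [Idx.lits ns, ι])) ns
          (bs.map fun b => body.subst (instI b.1) Ty.var (instE [b.2.1])))
  | collapse {ns nc τ ι} {cs : List (Ty S.BaseTy × List (Atom S))} :
      (∀ c ∈ cs, ∀ x ∈ c.2, IsAVal x) → ι.dims? = some (ns ++ nc) →
      Red δ
        (.frame (.arr τ ι) ns (cs.map fun c => .arr c.1 nc c.2))
        (.arr (.arr τ ι) (ns ++ nc) (cs.flatMap Prod.snd))

/-- Evaluation steps: contraction of a redex inside an evaluation context.  Evaluation proceeds from
left to right and not below binders. -/
inductive Step (δ : S.Op → List (Expr S) → Option (Expr S)) : Expr S → Expr S → Prop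
  | red {e e'} : Red δ e e' → Step δ e e'
  | box {tag ns vs ιs e e' τ as} : (∀ a ∈ vs, IsAVal a) → Step δ e e' →
      Step δ (.arr tag ns (vs ++ .box ιs e τ :: as)) (.arr tag ns (vs ++ .box ιs e' τ :: as))
  | cell {tag ns vs e e' es} : (∀ v ∈ vs, IsVal v) → Step δ e e' →
      Step δ (.frame tag ns (vs ++ e :: es)) (.frame tag ns (vs ++ e' :: es))
  | fn {f f' ins out ι args tag} : Step δ f f' →
      Step δ (.app f ins out ι args tag) (.app f' ins out ι args tag)
  | arg {f ins out ι vs e e' es tag} : IsVal f → (∀ v ∈ vs, IsVal v) → Step δ e e' →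
      Step δ (.app f ins out ι (vs ++ e :: es) tag) (.app f ins out ι (vs ++ e' :: es) tag)
  | tapp {f f' τs tag} : Step δ f f' → Step δ (.tapp f τs tag) (.tapp f' τs tag)
  | iapp {f f' ιs tag} : Step δ f f' → Step δ (.iapp f ιs tag) (.iapp f' ιs tag)
  | unbox {n e e' body bodyTag} : Step δ e e' →
      Step δ (.unbox n e body bodyTag) (.unbox n e' body bodyTag)

/-- An expression is stuck if it is not a value and takes no step. -/
def Stuck (δ : S.Op → List (Expr S) → Option (Expr S)) (e : Expr S) : Prop :=
  ¬ IsVal e ∧ ¬ ∃ e', Step δ e e'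

end ExplicitStep

/-! ## Erased terms -/

mutual
inductive EExpr (S : Sig.{u}) : Type u
  | var (x : ℕ)
  /-- `(array (n ...) a ...)` -/
  | arr (ns : List ℕ) (atoms : List (EAtom S))
  /-- `(frame ι e ...)`, with the shape `ι` of the resulting array -/
  | frame (ι : Idx) (cells : List (EExpr S))
  /-- `(f (e ι) ... ι')`: the list of the pairs of an argument and its cell shape is given as a list
  of arguments and a list of cell shapes; `ι'` is the shape of the result -/
  | app (f : EExpr S) (args : List (EExpr S)) (ιs : List Idx) (ι' : Idx)
  /-- `(i-app f ι ... ι')`, with the shape `ι'` of the result -/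
  | iapp (f : EExpr S) (ιs : List Idx) (ι' : Idx)
  /-- `(unbox (x ... y e) body ι)` with `n` index variables; `ι` is the shape of the body -/
  | unbox (n : ℕ) (e : EExpr S) (body : EExpr S) (ι : Idx)
inductive EAtom (S : Sig.{u}) : Type u
  | base (b : S.BaseVal)
  | op (o : S.Op)
  /-- `(λ (x ...) e)` with `n` variables -/
  | lam (n : ℕ) (body : EExpr S)
  /-- `(Iλ (x ...) e)` with `n` variables -/
  | ilam (n : ℕ) (body : EExpr S)
  /-- `(box ι ... e)` -/
  | box (ιs : List Idx) (e : EExpr S)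
end

section Erased
variable {S : Sig.{u}}

mutual
def EExpr.rename (ρI ρE : ℕ → ℕ) : EExpr S → EExpr S
  | .var x => .var (ρE x)
  | .arr ns atoms => .arr ns (EAtom.renames ρI ρE atoms)
  | .frame ι cells => .frame (ι.rename ρI) (EExpr.renames ρI ρE cells)
  | .app f args ιs ι' =>
      .app (f.rename ρI ρE) (EExpr.renames ρI ρE args) (Idx.renames ρI ιs) (ι'.rename ρI)
  | .iapp f ιs ι' => .iapp (f.rename ρI ρE) (Idx.renames ρI ιs) (ι'.rename ρI)
  | .unbox n e body ι =>
      .unbox n (e.rename ρI ρE) (body.rename (liftR n ρI) (liftR 1 ρE)) (ι.rename ρI)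
def EAtom.rename (ρI ρE : ℕ → ℕ) : EAtom S → EAtom S
  | .base b => .base b
  | .op o => .op o
  | .lam n body => .lam n (body.rename ρI (liftR n ρE))
  | .ilam n body => .ilam n (body.rename (liftR n ρI) ρE)
  | .box ιs e => .box (Idx.renames ρI ιs) (e.rename ρI ρE)
def EExpr.renames (ρI ρE : ℕ → ℕ) : List (EExpr S) → List (EExpr S)
  | [] => []
  | e :: es => e.rename ρI ρE :: EExpr.renames ρI ρE es
def EAtom.renames (ρI ρE : ℕ → ℕ) : List (EAtom S) → List (EAtom S)
  | [] => []
  | a :: as => a.rename ρI ρE :: EAtom.renames ρI ρE as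
end

def shiftEE (n : ℕ) (σ : ℕ → EExpr S) (k : ℕ) : EExpr S := (σ k).rename (· + n) id

def liftEE (n : ℕ) (σ : ℕ → EExpr S) (k : ℕ) : EExpr S :=
  if k < n then .var k else (σ (k - n)).rename id (· + n)

def instEE (es : List (EExpr S)) (k : ℕ) : EExpr S := (es[k]?).getD (.var (k - es.length))

mutual
/-- Simultaneous capture-avoiding substitution of index and term variables. -/
def EExpr.subst (σI : ℕ → Idx) (σE : ℕ → EExpr S) : EExpr S → EExpr S
  | .var x => σE x
  | .arr ns atoms => .arr ns (EAtom.substs σI σE atoms)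
  | .frame ι cells => .frame (ι.subst σI) (EExpr.substs σI σE cells)
  | .app f args ιs ι' =>
      .app (f.subst σI σE) (EExpr.substs σI σE args) (Idx.substs σI ιs) (ι'.subst σI)
  | .iapp f ιs ι' => .iapp (f.subst σI σE) (Idx.substs σI ιs) (ι'.subst σI)
  | .unbox n e body ι =>
      .unbox n (e.subst σI σE) (body.subst (liftI n σI) (liftEE 1 (shiftEE n σE))) (ι.subst σI)
def EAtom.subst (σI : ℕ → Idx) (σE : ℕ → EExpr S) : EAtom S → EAtom S
  | .base b => .base b
  | .op o => .op o
  | .lam n body => .lam n (body.subst σI (liftEE n σE))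
  | .ilam n body => .ilam n (body.subst (liftI n σI) (shiftEE n σE))
  | .box ιs e => .box (Idx.substs σI ιs) (e.subst σI σE)
def EExpr.substs (σI : ℕ → Idx) (σE : ℕ → EExpr S) : List (EExpr S) → List (EExpr S)
  | [] => []
  | e :: es => e.subst σI σE :: EExpr.substs σI σE es
def EAtom.substs (σI : ℕ → Idx) (σE : ℕ → EExpr S) : List (EAtom S) → List (EAtom S)
  | [] => []
  | a :: as => a.subst σI σE :: EAtom.substs σI σE as
end

mutual
/-- Erased values. -/
inductive EIsVal : EExpr S → Prop
  | arr {ns atoms} : (∀ a ∈ atoms, EIsAVal a) → EIsVal (.arr ns atoms)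
/-- Erased atomic values. -/
inductive EIsAVal : EAtom S → Prop
  | base {b} : EIsAVal (.base b)
  | op {o} : EIsAVal (.op o)
  | lam {n body} : EIsAVal (.lam n body)
  | ilam {n body} : EIsAVal (.ilam n body)
  | box {ιs e} : EIsVal e → EIsAVal (.box ιs e)
end

/-- An erased array literal in argument position whose shape is a frame followed by the cell shape
which the index `ι` given at this position prescribes. -/
structure EArgLit (S : Sig.{u}) where
  ι : Idx
  frame : List ℕ
  cell : List ℕ
  atoms : List (EAtom S)

def EArgLit.toExpr (a : EArgLit S) : EExpr S := .arr (a.frame ++ a.cell) a.atoms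

def EArgLit.Ok (a : EArgLit S) : Prop := a.ι.dims? = some a.cell ∧ ∀ x ∈ a.atoms, EIsAVal x

def EArgLit.lifted (np : List ℕ) (a : EArgLit S) : EExpr S :=
  .arr (np ++ a.cell) (replicateCells a.frame np a.cell.prod a.atoms)

def EArgLit.nthCell (j : ℕ) (a : EArgLit S) : EExpr S :=
  .arr a.cell (piece a.cell.prod a.atoms j)

/-- Contraction of an erased redex. -/
inductive ERed (δ : S.Op → List (EExpr S) → Option (EExpr S)) : EExpr S → EExpr S → Prop
  | lift {nf fs ι' np} {as : List (EArgLit S)} :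
      (∀ x ∈ fs, EIsAVal x) → (∀ a ∈ as, a.Ok) →
      IsMaxFrame (nf :: as.map EArgLit.frame) np →
      (∃ d ∈ nf :: as.map EArgLit.frame, d ≠ np) →
      ERed δ
        (.app (.arr nf fs) (as.map EArgLit.toExpr) (as.map EArgLit.ι) ι')
        (.app (.arr np (replicateCells nf np 1 fs)) (as.map (EArgLit.lifted np))
          (as.map EArgLit.ι) ι')
  | map {nf fs ι' no} {as : List (EArgLit S)} :
      (∀ x ∈ fs, EIsAVal x) → (∀ a ∈ as, a.Ok) →
      nf ≠ [] → (∀ a ∈ as, a.frame = nf) → ι'.dims? = some (nf ++ no) →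
      ERed δ
        (.app (.arr nf fs) (as.map EArgLit.toExpr) (as.map EArgLit.ι) ι')
        (.frame ι' (fs.mapIdx fun j f =>
          .app (.arr [] [f]) (as.map (EArgLit.nthCell j)) (as.map EArgLit.ι) (Idx.lits no)))
  | beta {n body ι'} {as : List (EArgLit S)} :
      (∀ a ∈ as, a.Ok ∧ a.frame = []) → n = as.length →
      ERed δ
        (.app (.arr [] [.lam n body]) (as.map EArgLit.toExpr) (as.map EArgLit.ι) ι')
        (body.subst Idx.var (instEE (as.map EArgLit.toExpr)))
  | delta {o ι' v} {as : List (EArgLit S)} :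
      (∀ a ∈ as, a.Ok ∧ a.frame = []) → δ o (as.map EArgLit.toExpr) = some v →
      ERed δ (.app (.arr [] [.op o]) (as.map EArgLit.toExpr) (as.map EArgLit.ι) ι') v
  | ibeta {ns ιs ι'} {bs : List (EExpr S)} :
      ERed δ
        (.iapp (.arr ns (bs.map fun b => .ilam ιs.length b)) ιs ι')
        (.frame ι' (bs.map fun b => b.subst (instI ιs) EExpr.var))
  | unbox {n ns body ι} {bs : List (List Idx × EExpr S)} :
      (∀ b ∈ bs, b.1.length = n ∧ EIsVal b.2) →
      ERed δ
        (.unbox n (.arr ns (bs.map fun b => .box b.1 b.2)) body ι)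
        (.frame (.append [Idx.lits ns, ι])
          (bs.map fun b => body.subst (instI b.1) (instEE [b.2])))
  | collapse {ns nc ι} {cs : List (List (EAtom S))} :
      (∀ c ∈ cs, ∀ x ∈ c, EIsAVal x) → ι.dims? = some (ns ++ nc) →
      ERed δ (.frame ι (cs.map fun c => .arr nc c)) (.arr (ns ++ nc) cs.flatten)

/-- Evaluation steps of erased terms. -/
inductive EStep (δ : S.Op → List (EExpr S) → Option (EExpr S)) : EExpr S → EExpr S → Prop
  | red {e e'} : ERed δ e e' → EStep δ e e'
  | box {ns vs ιs e e' as} : (∀ a ∈ vs, EIsAVal a) → EStep δ e e' →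
      EStep δ (.arr ns (vs ++ .box ιs e :: as)) (.arr ns (vs ++ .box ιs e' :: as))
  | cell {ι vs e e' es} : (∀ v ∈ vs, EIsVal v) → EStep δ e e' →
      EStep δ (.frame ι (vs ++ e :: es)) (.frame ι (vs ++ e' :: es))
  | fn {f f' args ιs ι'} : EStep δ f f' → EStep δ (.app f args ιs ι') (.app f' args ιs ι')
  | arg {f vs e e' es ιs ι'} : EIsVal f → (∀ v ∈ vs, EIsVal v) → EStep δ e e' →
      EStep δ (.app f (vs ++ e :: es) ιs ι') (.app f (vs ++ e' :: es) ιs ι')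
  | iapp {f f' ιs ι'} : EStep δ f f' → EStep δ (.iapp f ιs ι') (.iapp f' ιs ι')
  | unbox {n e e' body ι} : EStep δ e e' → EStep δ (.unbox n e body ι) (.unbox n e' body ι)

/-- An erased expression is stuck if it is not a value and takes no step. -/
def EStuck (δ : S.Op → List (EExpr S) → Option (EExpr S)) (e : EExpr S) : Prop :=
  ¬ EIsVal e ∧ ¬ ∃ e', EStep δ e e'

/-! ## Erasure

Erased terms have no types; the type variables of an explicit term become index variables.  As index
and type variables of explicit terms are numbered separately, erasure keeps track of the numbers of
their images: `ρT` for type variables and `ρI` for index variables. -/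

/-- Erasure of types: array types become their shapes, a type variable becomes an index variable, and
all other types become the scalar shape `(Shp)`. -/
def Ty.erase {B : Type u} (ρT ρI : ℕ → ℕ) : Ty B → Idx
  | .var k => .var (ρT k)
  | .arr _ ι => ι.rename ρI
  | _ => .shp []

mutual
def Expr.eraseIn (ρT ρI : ℕ → ℕ) : Expr S → EExpr S
  | .var x => .var x
  | .arr _ ns atoms => .arr ns (Atom.erasesIn ρT ρI atoms)
  | .frame tag _ cells => .frame (tag.erase ρT ρI) (Expr.erasesIn ρT ρI cells)
  | .app f ins _ _ args tag =>
      .app (f.eraseIn ρT ρI) (Expr.erasesIn ρT ρI args) (ins.map (Ty.erase ρT ρI))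
        (tag.erase ρT ρI)
  | .tapp f τs tag => .iapp (f.eraseIn ρT ρI) (τs.map (Ty.erase ρT ρI)) (tag.erase ρT ρI)
  | .iapp f ιs tag => .iapp (f.eraseIn ρT ρI) (Idx.renames ρI ιs) (tag.erase ρT ρI)
  | .unbox n e body bodyTag =>
      .unbox n (e.eraseIn ρT ρI) (body.eraseIn (fun k => ρT k + n) (liftR n ρI))
        (bodyTag.erase ρT ρI)
def Atom.eraseIn (ρT ρI : ℕ → ℕ) : Atom S → EAtom S
  | .base b => .base b
  | .op o => .op o
  | .lam τs body => .lam τs.length (body.eraseIn ρT ρI)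
  | .tlam ks body =>
      .ilam ks.length (body.eraseIn (liftR ks.length ρT) (fun k => ρI k + ks.length))
  | .ilam γs body =>
      .ilam γs.length (body.eraseIn (fun k => ρT k + γs.length) (liftR γs.length ρI))
  | .box ιs e _ => .box (Idx.renames ρI ιs) (e.eraseIn ρT ρI)
def Expr.erasesIn (ρT ρI : ℕ → ℕ) : List (Expr S) → List (EExpr S)
  | [] => []
  | e :: es => e.eraseIn ρT ρI :: Expr.erasesIn ρT ρI es
def Atom.erasesIn (ρT ρI : ℕ → ℕ) : List (Atom S) → List (EAtom S)
  | [] => []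
  | a :: as => a.eraseIn ρT ρI :: Atom.erasesIn ρT ρI as
end

/-- Erasure of expressions.  Free type variables (if any) become the even index variables, free index
variables the odd ones. -/
def Expr.erase (e : Expr S) : EExpr S := e.eraseIn (fun k => 2 * k) (fun k => 2 * k + 1)

end Erased

/-- An interpretation of the primitive operators: partial functions on explicit and on erased values.
The two interpretations are required to agree: on well-typed argument values, the erased operator is
defined where the explicit one is, and its result is the erasure of the explicit result. -/
structure Prims (S : Sig.{u}) where
  delta : S.Op → List (Expr S) → Option (Expr S)
  edelta : S.Op → List (EExpr S) → Option (EExpr S)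
  agree : ∀ (o : S.Op) (τs : List (Ty S.BaseTy)) (τ : Ty S.BaseTy) (vs : List (Expr S)),
    S.opTy o = .fn τs τ → (∀ v ∈ vs, IsVal v) → List.Forall₂ (HasTy [] [] []) vs τs →
    edelta o (vs.map Expr.erase) = (delta o vs).map Expr.erase

end Remora

namespace Remora

/-! ## Indices -/

-- Both evaluators decide by nearly the same data: constructors, literal shapes, arities of binders,
-- and the sequences denoted by the shapes stored in tags. Erasure keeps these, and renumbering the
-- variables of an index does not change its closed value (`Idx.dims?_rename`). It forgets a few
-- things, such as whether an abstraction binds types or indices and the shape of a frame without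
-- its cells. Typing shows that on closed well-typed terms the forgotten data never changes whether
-- a rule applies.
--
-- The proof is an induction on the typing derivation. Evaluation contexts do not go below binders,
-- so every subterm that may be evaluated is closed and has an induction hypothesis; preservation of
-- types is not needed. If some immediate subterm in evaluation position is not a value, the first
-- such subterm decides what happens, and it is the same one on both sides (`Lock.list`,
-- `Lockstep.app` and its companions).
--
-- If all of them are values, the term itself must be a redex on both sides, with corresponding
-- contracta, or on neither (`RedLock`). Inversion of typing (`HasTy.arr_arr_inv`, `AtomTy.of_fn`,
-- `AtomTy.of_univ`, `AtomTy.of_pi`, `AtomTy.of_sigma`) gives the shapes of the literals and the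
-- possible forms of their atoms. A frame then always collapses. An application lifts if its frames
-- differ, maps if they are equal and nonempty, and otherwise is a candidate for β or δ. The redex
-- can be missing only because of primitive operators: δ may be undefined, which `Prims.agree`
-- transfers to the erased side, or an operator may have a universal, product or sum type and stand
-- where an abstraction or a box is needed. To exclude all other rules in the δ case, the splitting
-- of an argument shape into frame and cell must be unique (`ArgLit.eq_of_ok`, `EArgLit.eq_of_ok`).
--
-- The contracta correspond because erasure commutes with substitution (`Expr.eraseIn_subst`). Since
-- type and index variables are merged into one erased numbering, this is proved for arbitrary
-- numberings related by commuting squares, a condition which is stable under all kinds of binders.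

theorem Idx.renames_eq_map (ρ : ℕ → ℕ) (ιs : List Idx) :
    Idx.renames ρ ιs = ιs.map (Idx.rename ρ) := by
  induction ιs with
  | nil => rfl
  | cons ι ιs ih => simp [Idx.renames, ih]

theorem Idx.substs_eq_map (σ : ℕ → Idx) (ιs : List Idx) :
    Idx.substs σ ιs = ιs.map (Idx.subst σ) := by
  induction ιs with
  | nil => rfl
  | cons ι ιs ih => simp [Idx.substs, ih]

mutual
theorem Idx.rename_rename (a b : ℕ → ℕ) :
    ∀ ι : Idx, (ι.rename a).rename b = ι.rename (fun k => b (a k))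
  | .var k => rfl
  | .nat n => rfl
  | .shp ιs => by simp [Idx.rename, Idx.renames_renames a b ιs]
  | .plus ιs => by simp [Idx.rename, Idx.renames_renames a b ιs]
  | .append ιs => by simp [Idx.rename, Idx.renames_renames a b ιs]
theorem Idx.renames_renames (a b : ℕ → ℕ) :
    ∀ ιs : List Idx, Idx.renames b (Idx.renames a ιs) = Idx.renames (fun k => b (a k)) ιs
  | [] => rfl
  | ι :: ιs => by simp [Idx.renames, Idx.rename_rename a b ι, Idx.renames_renames a b ιs]
end

theorem Idx.rename_rename_comm {a b c d : ℕ → ℕ} (h : ∀ k, b (a k) = d (c k)) (ι : Idx) :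
    (ι.rename a).rename b = (ι.rename c).rename d := by
  simp only [Idx.rename_rename, h]

theorem Idx.renames_renames_comm {a b c d : ℕ → ℕ} (h : ∀ k, b (a k) = d (c k))
    (ιs : List Idx) : Idx.renames b (Idx.renames a ιs) = Idx.renames d (Idx.renames c ιs) := by
  simp only [Idx.renames_renames, h]

mutual
-- The numberings before and after the substitution, `ρ` and `ρ'`, may differ, because a
-- substitution that instantiates a binder leaves its scope. The hypothesis is the square on
-- variables.
theorem Idx.subst_rename_comm {σ σ' : ℕ → Idx} {ρ ρ' : ℕ → ℕ}
    (h : ∀ k, (σ k).rename ρ' = σ' (ρ k)) :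
    ∀ ι : Idx, (ι.subst σ).rename ρ' = (ι.rename ρ).subst σ'
  | .var k => by simp [Idx.rename, Idx.subst, h]
  | .nat n => rfl
  | .shp ιs => by simp [Idx.rename, Idx.subst, Idx.substs_renames_comm h ιs]
  | .plus ιs => by simp [Idx.rename, Idx.subst, Idx.substs_renames_comm h ιs]
  | .append ιs => by simp [Idx.rename, Idx.subst, Idx.substs_renames_comm h ιs]
theorem Idx.substs_renames_comm {σ σ' : ℕ → Idx} {ρ ρ' : ℕ → ℕ}
    (h : ∀ k, (σ k).rename ρ' = σ' (ρ k)) :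
    ∀ ιs : List Idx, Idx.renames ρ' (Idx.substs σ ιs) = Idx.substs σ' (Idx.renames ρ ιs)
  | [] => rfl
  | ι :: ιs => by
      simp [Idx.renames, Idx.substs, Idx.subst_rename_comm h ι, Idx.substs_renames_comm h ιs]
end

-- Values of indices and validity of equations between them

mutual
theorem Idx.eval_rename (r : ℕ → ℕ) (ρ : ℕ → Option IVal) :
    ∀ ι : Idx, (ι.rename r).eval ρ = ι.eval (fun k => ρ (r k))
  | .var k => rfl
  | .nat n => rfl
  | .shp ιs => by simp [Idx.rename, Idx.eval, Idx.evalDims_renames r ρ ιs]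
  | .plus ιs => by simp [Idx.rename, Idx.eval, Idx.evalDims_renames r ρ ιs]
  | .append ιs => by simp [Idx.rename, Idx.eval, Idx.evalShapes_renames r ρ ιs]
theorem Idx.evalDims_renames (r : ℕ → ℕ) (ρ : ℕ → Option IVal) :
    ∀ ιs : List Idx, Idx.evalDims ρ (Idx.renames r ιs) = Idx.evalDims (fun k => ρ (r k)) ιs
  | [] => rfl
  | ι :: ιs => by
      simp [Idx.renames, Idx.evalDims, Idx.eval_rename r ρ ι, Idx.evalDims_renames r ρ ιs]
theorem Idx.evalShapes_renames (r : ℕ → ℕ) (ρ : ℕ → Option IVal) :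
    ∀ ιs : List Idx, Idx.evalShapes ρ (Idx.renames r ιs) = Idx.evalShapes (fun k => ρ (r k)) ιs
  | [] => rfl
  | ι :: ιs => by
      simp [Idx.renames, Idx.evalShapes, Idx.eval_rename r ρ ι, Idx.evalShapes_renames r ρ ιs]
end

/-- The empty assignment cannot see how variables are numbered. Hence the side conditions on shapes
in the erased rules have the same truth value as in the explicit rules. -/
theorem Idx.dims?_rename (r : ℕ → ℕ) (ι : Idx) : (ι.rename r).dims? = ι.dims? := by
  simp [Idx.dims?, Idx.eval_rename]

theorem Idx.evalDims_cons_eq_some {ρ : ℕ → Option IVal} {ι : Idx} {ιs : List Idx} {l : List ℕ} :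
    Idx.evalDims ρ (ι :: ιs) = some l ↔
      ∃ n ns, ι.eval ρ = some (.dim n) ∧ Idx.evalDims ρ ιs = some ns ∧ n :: ns = l := by
  rw [Idx.evalDims]
  split <;> simp_all

theorem Idx.evalShapes_cons_eq_some {ρ : ℕ → Option IVal} {ι : Idx} {ιs : List Idx}
    {l : List (List ℕ)} :
    Idx.evalShapes ρ (ι :: ιs) = some l ↔
      ∃ n ns, ι.eval ρ = some (.shape n) ∧ Idx.evalShapes ρ ιs = some ns ∧ n :: ns = l := by
  rw [Idx.evalShapes]
  split <;> simp_all

mutual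
-- An index with a value under the empty assignment keeps this value under every assignment.
-- Validity of an equation between closed shapes can therefore be tested at the empty assignment
-- alone.
theorem Idx.eval_mono {ρ ρ' : ℕ → Option IVal} (h : ∀ k v, ρ k = some v → ρ' k = some v) :
    ∀ (ι : Idx) {v}, ι.eval ρ = some v → ι.eval ρ' = some v
  | .var k, v, hv => h k v hv
  | .nat n, v, hv => hv
  | .shp ιs, v, hv => by
      simp only [Idx.eval, Option.map_eq_some_iff] at hv ⊢
      obtain ⟨l, hl, rfl⟩ := hv
      exact ⟨l, Idx.evalDims_mono h ιs hl, rfl⟩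
  | .plus ιs, v, hv => by
      simp only [Idx.eval, Option.map_eq_some_iff] at hv ⊢
      obtain ⟨l, hl, rfl⟩ := hv
      exact ⟨l, Idx.evalDims_mono h ιs hl, rfl⟩
  | .append ιs, v, hv => by
      simp only [Idx.eval, Option.map_eq_some_iff] at hv ⊢
      obtain ⟨l, hl, rfl⟩ := hv
      exact ⟨l, Idx.evalShapes_mono h ιs hl, rfl⟩
theorem Idx.evalDims_mono {ρ ρ' : ℕ → Option IVal} (h : ∀ k v, ρ k = some v → ρ' k = some v) :
    ∀ (ιs : List Idx) {l}, Idx.evalDims ρ ιs = some l → Idx.evalDims ρ' ιs = some l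
  | [], l, hl => hl
  | ι :: ιs, l, hl => by
      rw [Idx.evalDims_cons_eq_some] at hl ⊢
      obtain ⟨n, ns, h1, h2, rfl⟩ := hl
      exact ⟨n, ns, Idx.eval_mono h ι h1, Idx.evalDims_mono h ιs h2, rfl⟩
theorem Idx.evalShapes_mono {ρ ρ' : ℕ → Option IVal}
    (h : ∀ k v, ρ k = some v → ρ' k = some v) :
    ∀ (ιs : List Idx) {l}, Idx.evalShapes ρ ιs = some l → Idx.evalShapes ρ' ιs = some l
  | [], l, hl => hl
  | ι :: ιs, l, hl => by
      rw [Idx.evalShapes_cons_eq_some] at hl ⊢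
      obtain ⟨n, ns, h1, h2, rfl⟩ := hl
      exact ⟨n, ns, Idx.eval_mono h ι h1, Idx.evalShapes_mono h ιs h2, rfl⟩
end

/-- Validity of an equation only asserts that some common sort exists; uniqueness identifies the two
middle sorts in transitivity. -/
theorem HasSort.unique {Θ : List Srt} {ι : Idx} {γ γ' : Srt} (h : HasSort Θ ι γ)
    (h' : HasSort Θ ι γ') : γ = γ' := by
  cases h <;> cases h' <;> simp_all

theorem evalDims_total {ρ : ℕ → Option IVal} {ιs : List Idx}
    (h : ∀ ι ∈ ιs, ∃ v, ι.eval ρ = some v ∧ v.srt = .dim) : ∃ l, Idx.evalDims ρ ιs = some l := by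
  induction ιs with
  | nil => exact ⟨[], rfl⟩
  | cons ι ιs ih =>
    obtain ⟨v, hv, hs⟩ := h ι (by simp)
    obtain ⟨l, hl⟩ := ih fun ι' h' => h ι' (by simp [h'])
    cases v with
    | dim n => exact ⟨n :: l, Idx.evalDims_cons_eq_some.2 ⟨n, l, hv, hl, rfl⟩⟩
    | shape n => simp [IVal.srt] at hs

theorem evalShapes_total {ρ : ℕ → Option IVal} {ιs : List Idx}
    (h : ∀ ι ∈ ιs, ∃ v, ι.eval ρ = some v ∧ v.srt = .shape) :
    ∃ l, Idx.evalShapes ρ ιs = some l := by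
  induction ιs with
  | nil => exact ⟨[], rfl⟩
  | cons ι ιs ih =>
    obtain ⟨v, hv, hs⟩ := h ι (by simp)
    obtain ⟨l, hl⟩ := ih fun ι' h' => h ι' (by simp [h'])
    cases v with
    | dim n => simp [IVal.srt] at hs
    | shape n => exact ⟨n :: l, Idx.evalShapes_cons_eq_some.2 ⟨n, l, hv, hl, rfl⟩⟩

theorem HasSort.eval_total {Θ : List Srt} {ρ : ℕ → Option IVal}
    (hρ : ∀ k γ, Θ[k]? = some γ → ∃ v, ρ k = some v ∧ v.srt = γ) {ι : Idx} {γ : Srt}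
    (h : HasSort Θ ι γ) : ∃ v, ι.eval ρ = some v ∧ v.srt = γ := by
  induction h with
  | var h => exact hρ _ _ h
  | nat => exact ⟨_, rfl, rfl⟩
  | shp _ ih =>
    obtain ⟨l, hl⟩ := evalDims_total ih
    exact ⟨.shape l, by simp [Idx.eval, hl], rfl⟩
  | plus _ ih =>
    obtain ⟨l, hl⟩ := evalDims_total ih
    exact ⟨.dim l.sum, by simp [Idx.eval, hl], rfl⟩
  | append _ ih =>
    obtain ⟨l, hl⟩ := evalShapes_total ih
    exact ⟨.shape l.flatten, by simp [Idx.eval, hl], rfl⟩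

theorem Idx.dims?_eq_some {ι : Idx} {ns : List ℕ} :
    ι.dims? = some ns ↔ ι.eval (fun _ => none) = some (.shape ns) := by
  unfold Idx.dims?
  split <;> simp_all

/-- A closed index of sort `Shape` denotes a sequence of dimensions. -/
theorem HasSort.dims?_isSome {ι : Idx} (h : HasSort [] ι .shape) : ∃ ns, ι.dims? = some ns := by
  obtain ⟨v, hv, hs⟩ := h.eval_total (ρ := fun _ => none) (by simp)
  cases v with
  | dim n => simp [IVal.srt] at hs
  | shape ns => exact ⟨ns, Idx.dims?_eq_some.2 hv⟩

theorem Idx.dims?_append {ι ι' : Idx} {ns : List ℕ} :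
    (Idx.append [ι, ι']).dims? = some ns ↔
      ∃ n n', ι.dims? = some n ∧ ι'.dims? = some n' ∧ n ++ n' = ns := by
  simp only [Idx.dims?_eq_some, Idx.eval, Option.map_eq_some_iff, IVal.shape.injEq]
  constructor
  · rintro ⟨l, hl, rfl⟩
    obtain ⟨n, l', h1, h2, rfl⟩ := Idx.evalShapes_cons_eq_some.1 hl
    obtain ⟨n', l'', h3, h4, rfl⟩ := Idx.evalShapes_cons_eq_some.1 h2
    simp only [Idx.evalShapes, Option.some.injEq] at h4
    subst h4
    exact ⟨n, n', h1, h3, by simp⟩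
  · rintro ⟨n, n', h1, h2, rfl⟩
    exact ⟨[n, n'], by simp [Idx.evalShapes, h1, h2], by simp⟩

theorem Idx.eval_lits (ρ : ℕ → Option IVal) (ns : List ℕ) :
    (Idx.lits ns).eval ρ = some (.shape ns) := by
  have h : Idx.evalDims ρ (ns.map Idx.nat) = some ns := by
    induction ns with
    | nil => rfl
    | cons n ns ih => simp [Idx.evalDims, Idx.eval, ih]
  simp [Idx.lits, Idx.eval, h]

theorem Idx.dims?_lits (ns : List ℕ) : (Idx.lits ns).dims? = some ns :=
  Idx.dims?_eq_some.2 (Idx.eval_lits _ ns)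

theorem Idx.rename_lits (ρ : ℕ → ℕ) (ns : List ℕ) : (Idx.lits ns).rename ρ = Idx.lits ns := by
  simp [Idx.lits, Idx.rename, Idx.renames_eq_map]

theorem HasSort.append_pair {Θ : List Srt} {ι ι' : Idx} :
    HasSort Θ (.append [ι, ι']) .shape ↔ HasSort Θ ι .shape ∧ HasSort Θ ι' .shape := by
  constructor
  · rintro ⟨⟩
    simp_all
  · rintro ⟨h, h'⟩
    exact .append (by simp [h, h'])

theorem IdxEqv.symm {Θ : List Srt} {ι ι' : Idx} (h : IdxEqv Θ ι ι') : IdxEqv Θ ι' ι := by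
  obtain ⟨⟨γ, h1, h2⟩, h⟩ := h
  exact ⟨⟨γ, h2, h1⟩, fun ρ hρ => (h ρ hρ).symm⟩

theorem IdxEqv.trans {Θ : List Srt} {ι ι' ι'' : Idx} (h : IdxEqv Θ ι ι')
    (h' : IdxEqv Θ ι' ι'') : IdxEqv Θ ι ι'' := by
  obtain ⟨⟨γ, h1, h2⟩, h⟩ := h
  obtain ⟨⟨γ', h3, h4⟩, h'⟩ := h'
  obtain rfl := h2.unique h3
  exact ⟨⟨γ, h1, h4⟩, fun ρ hρ => (h ρ hρ).trans (h' ρ hρ)⟩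

theorem IdxEqv.hasSort {Θ : List Srt} {ι ι' : Idx} {γ : Srt} (h : IdxEqv Θ ι ι')
    (h' : HasSort Θ ι' γ) : HasSort Θ ι γ := by
  obtain ⟨⟨γ', h1, h2⟩, -⟩ := h
  exact h2.unique h' ▸ h1

theorem IdxEqv.dims?_eq {ι ι' : Idx} (h : IdxEqv [] ι ι') : ι.dims? = ι'.dims? := by
  simp [Idx.dims?, h.2 (fun _ => none) (by simp)]

/-- Closed shapes which denote the same sequence are equivalent. -/
theorem IdxEqv.of_dims? {ι ι' : Idx} {ns : List ℕ} (h : HasSort [] ι .shape)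
    (h' : HasSort [] ι' .shape) (hι : ι.dims? = some ns) (hι' : ι'.dims? = some ns) :
    IdxEqv [] ι ι' := by
  refine ⟨⟨_, h, h'⟩, fun ρ _ => ?_⟩
  rw [Idx.eval_mono (by simp) ι (Idx.dims?_eq_some.1 hι),
    Idx.eval_mono (by simp) ι' (Idx.dims?_eq_some.1 hι')]

/-- The witness `w` is closed, so evaluating the concatenation at the empty assignment exhibits an
actual prefix of the sequence. -/
theorem IdxPrefix.dims? {ι ι' : Idx} {ns' : List ℕ} (h : IdxPrefix [] ι ι')
    (h' : ι'.dims? = some ns') : ∃ ns, ι.dims? = some ns ∧ ns <+: ns' := by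
  obtain ⟨w, -, hw⟩ := h
  rw [← hw.dims?_eq, Idx.dims?_append] at h'
  obtain ⟨n, n', h1, -, rfl⟩ := h'
  exact ⟨n, h1, List.prefix_append _ _⟩

theorem IdxPrefix.hasSort {Θ : List Srt} {ι ι' : Idx} (h : IdxPrefix Θ ι ι') :
    HasSort Θ ι .shape := by
  obtain ⟨w, -, ⟨⟨γ, h1, -⟩, -⟩⟩ := h
  cases h1 with
  | append h => exact h _ (by simp)

/-! ## Type equivalence -/

theorem getElem_mem_zip {α β : Type*} {l : List α} {l' : List β} {i : ℕ} (h : i < l.length)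
    (h' : i < l'.length) : (l[i], l'[i]) ∈ l.zip l' := by
  rw [← List.getElem_zip (h := by simp; omega)]
  exact List.getElem_mem _

section Ty
variable {B : Type u}

theorem TEqv.symm {Θ : List Srt} {τ τ' : Ty B} (h : TEqv Θ τ τ') : TEqv Θ τ' τ := by
  induction h with
  | refl => exact .refl
  | arr _ h ih => exact .arr ih h.symm
  | fn hl _ _ ih ih' =>
    refine .fn hl.symm (fun p hp => ?_) ih'
    rw [← List.zip_swap] at hp
    obtain ⟨q, hq, rfl⟩ := List.mem_map.1 hp
    exact ih q hq
  | univ _ ih => exact .univ ih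
  | pi _ ih => exact .pi ih
  | sigma _ ih => exact .sigma ih

/-- Type equivalence is generated by reflexivity and congruence only, so transitivity has to be
derived. It merges consecutive conversions in a typing derivation into one, which the inversion
lemmas rely on. -/
theorem TEqv.trans {Θ : List Srt} {τ τ' τ'' : Ty B} (h : TEqv Θ τ τ') (h' : TEqv Θ τ' τ'') :
    TEqv Θ τ τ'' := by
  induction h generalizing τ'' with
  | refl => exact h'
  | arr h₁ h₂ ih =>
    cases h' with
    | refl => exact .arr h₁ h₂
    | arr h₃ h₄ => exact .arr (ih h₃) (h₂.trans h₄)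
  | @fn Θ ins ins' out out' hl h₁ h₂ ih ih' =>
    cases h' with
    | refl => exact .fn hl h₁ h₂
    | @fn _ _ ins'' _ _ hl' h₃ h₄ =>
      refine .fn (hl.trans hl') (fun p hp => ?_) (ih' h₄)
      obtain ⟨i, hi, rfl⟩ := List.mem_iff_getElem.1 hp
      simp only [List.length_zip, lt_inf_iff] at hi
      rw [List.getElem_zip]
      have hi' : i < ins'.length := by omega
      exact ih (ins[i], ins'[i]) (getElem_mem_zip _ _)
        (h₃ (ins'[i], ins''[i]) (getElem_mem_zip _ _))
  | univ h ih =>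
    cases h' with
    | refl => exact .univ h
    | univ h₃ => exact .univ (ih h₃)
  | pi h ih =>
    cases h' with
    | refl => exact .pi h
    | pi h₃ => exact .pi (ih h₃)
  | sigma h ih =>
    cases h' with
    | refl => exact .sigma h
    | sigma h₃ => exact .sigma (ih h₃)

theorem TEqv.hasKind {Θ : List Srt} {Δ : List Knd} {τ τ' : Ty B} {k : Knd} (h : TEqv Θ τ τ')
    (h' : HasKind Θ Δ τ' k) : HasKind Θ Δ τ k := by
  induction h generalizing Δ k with
  | refl => exact h'
  | arr _ h ih =>
    cases h' with
    | arr h₁ h₂ => exact .arr (ih h₁) (h.hasSort h₂)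
  | @fn Θ ins ins' out out' hl h₁ h₂ ih ih' =>
    cases h' with
    | fn h₃ h₄ =>
      refine .fn (fun τ hτ => ?_) (ih' h₄)
      obtain ⟨i, hi, rfl⟩ := List.mem_iff_getElem.1 hτ
      have hi' : i < ins'.length := by omega
      exact ih (ins[i], ins'[i]) (getElem_mem_zip _ _)
        (h₃ _ (by simp))
  | univ _ ih =>
    cases h' with
    | univ h => exact .univ (ih h)
  | pi _ ih =>
    cases h' with
    | pi h => exact .pi (ih h)
  | sigma _ ih =>
    cases h' with
    | sigma h => exact .sigma (ih h)

/-- A type equivalent to a closed array type is an array type whose shape denotes the same. -/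
theorem TEqv.exists_arr {σ τ : Ty B} {ι : Idx} (h : TEqv [] σ (.arr τ ι)) :
    ∃ τ' ι', σ = .arr τ' ι' ∧ TEqv [] τ' τ ∧ ι'.dims? = ι.dims? := by
  cases h with
  | refl => exact ⟨_, _, rfl, .refl, rfl⟩
  | arr h h' => exact ⟨_, _, rfl, h, h'.dims?_eq⟩

end Ty

/-! ## Inversion of typing -/

section Explicit
variable {S : Sig.{u}}

/-- Recursion on the derivation strips the conversions above the rule for literals; the equation for
`e` keeps the subject general during this recursion. -/
theorem HasTy.arr_inv {Θ : List Srt} {Δ : List Knd} {Γ : List (Ty S.BaseTy)}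
    {e : Expr S} {σ tag : Ty S.BaseTy} {ns : List ℕ} {atoms : List (Atom S)} :
    HasTy Θ Δ Γ e σ → e = .arr tag ns atoms →
      ∃ τ, TEqv Θ σ (.arr τ (Idx.lits ns)) ∧ (∀ a ∈ atoms, AtomTy Θ Δ Γ a τ) ∧
        HasKind Θ Δ τ .atom ∧ atoms.length = ns.prod
  | .eqv h h', he => by
      obtain ⟨τ, h₁, h₂⟩ := h.arr_inv he
      exact ⟨τ, h'.trans h₁, h₂⟩
  | .arr h₁ h₂ h₃ _, he => by
      cases he
      exact ⟨_, .refl, h₁, h₂, h₃⟩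

/-- What is known about a closed array literal of a given array type. -/
theorem HasTy.arr_arr_inv {tag τ : Ty S.BaseTy} {ι : Idx} {ns : List ℕ} {atoms : List (Atom S)}
    (h : HasTy [] [] [] (.arr tag ns atoms) (.arr τ ι)) :
    ι.dims? = some ns ∧ (∀ a ∈ atoms, AtomTy [] [] [] a τ) ∧ HasKind [] [] τ .atom ∧
      atoms.length = ns.prod := by
  obtain ⟨τ', h₁, h₂, h₃, h₄⟩ := h.arr_inv rfl
  obtain ⟨_, _, h, h₅, h₆⟩ := h₁.exists_arr
  cases h
  exact ⟨h₆.trans (Idx.dims?_lits ns), fun a ha => .eqv (h₂ a ha) h₅, h₅.hasKind h₃, h₄⟩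

/-- The types which the typing rules assign to an atom. -/
def Atom.HasHeadTy : Atom S → Ty S.BaseTy → Prop
  | .base b, σ => σ = .base (S.valTy b)
  | .op o, σ => σ = S.opTy o
  | .lam τs _, σ => ∃ τ, σ = .fn τs τ
  | .tlam ks _, σ => ∃ τ, σ = .univ ks τ
  | .ilam γs _, σ => ∃ τ, σ = .pi γs τ
  | .box ιs _ _, σ => ∃ γs τ, σ = .sigma γs τ ∧ ιs.length = γs.length

theorem AtomTy.exists_hasHeadTy {Θ : List Srt} {Δ : List Knd} {Γ : List (Ty S.BaseTy)}
    {a : Atom S} {σ : Ty S.BaseTy} : AtomTy Θ Δ Γ a σ → ∃ σ', TEqv Θ σ σ' ∧ a.HasHeadTy σ'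
  | .eqv h h' => by
      obtain ⟨σ', h₁, h₂⟩ := h.exists_hasHeadTy
      exact ⟨σ', h'.trans h₁, h₂⟩
  | .base => ⟨_, .refl, rfl⟩
  | .op => ⟨_, .refl, rfl⟩
  | .lam _ _ => ⟨_, .refl, _, rfl⟩
  | .tlam _ => ⟨_, .refl, _, rfl⟩
  | .ilam _ => ⟨_, .refl, _, rfl⟩
  | .box h _ _ => ⟨_, .refl, _, _, rfl, h.length_eq⟩

/-- For a λ-abstraction only the arity matters, since this is all that β checks. For an operator the
declared input types are related to the expected ones, because the agreement of `delta` and `edelta`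
is stated for the declared types. -/
theorem AtomTy.of_fn {Θ : List Srt} {Δ : List Knd} {Γ : List (Ty S.BaseTy)} {a : Atom S}
    {ins : List (Ty S.BaseTy)} {out : Ty S.BaseTy} (h : AtomTy Θ Δ Γ a (.fn ins out)) :
    (∃ τs body, a = .lam τs body ∧ τs.length = ins.length) ∨
      ∃ o τs τ, a = .op o ∧ S.opTy o = .fn τs τ ∧ List.Forall₂ (TEqv Θ) ins τs := by
  obtain ⟨σ, h₁, h₂⟩ := h.exists_hasHeadTy
  have hσ : ∃ τs τ, σ = .fn τs τ ∧ List.Forall₂ (TEqv Θ) ins τs := by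
    cases h₁ with
    | refl => exact ⟨_, _, rfl, List.forall₂_same.2 fun _ _ => .refl⟩
    | fn hl h _ => exact ⟨_, _, rfl, List.forall₂_iff_zip.2 ⟨hl, fun h' => h _ h'⟩⟩
  obtain ⟨τs, τ, rfl, hτs⟩ := hσ
  cases a with
  | lam τs' body =>
    obtain ⟨τ', h⟩ := h₂
    cases h
    exact .inl ⟨_, _, rfl, hτs.length_eq.symm⟩
  | op o => exact .inr ⟨o, τs, τ, rfl, h₂.symm, hτs⟩
  | _ => simp [Atom.HasHeadTy] at h₂

/-- Equivalence never changes the list of bound kinds, so the binder is exactly `ks`. Operators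
cannot be excluded: their types are arbitrary closed types of kind `Atom`. -/
theorem AtomTy.of_univ {Θ : List Srt} {Δ : List Knd} {Γ : List (Ty S.BaseTy)} {a : Atom S}
    {ks : List Knd} {τ : Ty S.BaseTy} (h : AtomTy Θ Δ Γ a (.univ ks τ)) :
    (∃ body, a = .tlam ks body) ∨ ∃ o, a = .op o := by
  obtain ⟨σ, h₁, h₂⟩ := h.exists_hasHeadTy
  have hσ : ∃ τ', σ = .univ ks τ' := by cases h₁ <;> exact ⟨_, rfl⟩
  obtain ⟨τ', rfl⟩ := hσ
  cases a <;> simp [Atom.HasHeadTy] at h₂ ⊢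
  exact h₂.symm

theorem AtomTy.of_pi {Θ : List Srt} {Δ : List Knd} {Γ : List (Ty S.BaseTy)} {a : Atom S}
    {γs : List Srt} {τ : Ty S.BaseTy} (h : AtomTy Θ Δ Γ a (.pi γs τ)) :
    (∃ body, a = .ilam γs body) ∨ ∃ o, a = .op o := by
  obtain ⟨σ, h₁, h₂⟩ := h.exists_hasHeadTy
  have hσ : ∃ τ', σ = .pi γs τ' := by cases h₁ <;> exact ⟨_, rfl⟩
  obtain ⟨τ', rfl⟩ := hσ
  cases a <;> simp [Atom.HasHeadTy] at h₂ ⊢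
  exact h₂.symm

theorem AtomTy.of_sigma {Θ : List Srt} {Δ : List Knd} {Γ : List (Ty S.BaseTy)} {a : Atom S}
    {γs : List Srt} {τ : Ty S.BaseTy} (h : AtomTy Θ Δ Γ a (.sigma γs τ)) :
    (∃ ιs e τ', a = .box ιs e τ' ∧ ιs.length = γs.length) ∨ ∃ o, a = .op o := by
  obtain ⟨σ, h₁, h₂⟩ := h.exists_hasHeadTy
  have hσ : ∃ τ', σ = .sigma γs τ' := by cases h₁ <;> exact ⟨_, rfl⟩
  obtain ⟨τ', rfl⟩ := hσ
  cases a <;> simp [Atom.HasHeadTy] at h₂ ⊢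
  exact h₂

end Explicit

/-! ## Erasure commutes with renaming and substitution -/

theorem liftR_comm {a b c d : ℕ → ℕ} (n : ℕ) (h : ∀ k, b (a k) = d (c k)) (k : ℕ) :
    liftR n b (liftR n a k) = liftR n d (liftR n c k) := by
  unfold liftR
  split_ifs with h₁ <;> simp_all

theorem liftR_add (n : ℕ) (a : ℕ → ℕ) (k : ℕ) : liftR n a (k + n) = a k + n := by
  simp [liftR]

section Ty
variable {B : Type u}

theorem Ty.renames_eq_map (ρI ρT : ℕ → ℕ) (τs : List (Ty B)) :
    Ty.renames ρI ρT τs = τs.map (Ty.rename ρI ρT) := by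
  induction τs with
  | nil => rfl
  | cons τ τs ih => simp [Ty.renames, ih]

theorem Ty.substs_eq_map (σI : ℕ → Idx) (σT : ℕ → Ty B) (τs : List (Ty B)) :
    Ty.substs σI σT τs = τs.map (Ty.subst σI σT) := by
  induction τs with
  | nil => rfl
  | cons τ τs ih => simp [Ty.substs, ih]

/-- Erasure looks only at the head of a type and at the shape of an array type, so no induction on
types is needed and binders inside types play no role. -/
theorem Ty.erase_rename {ρI ρT ρ tI tT uI uT : ℕ → ℕ} (hI : ∀ k, tI (ρI k) = ρ (uI k))
    (hT : ∀ k, tT (ρT k) = ρ (uT k)) (τ : Ty B) :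
    (τ.rename ρI ρT).erase tT tI = (τ.erase uT uI).rename ρ := by
  cases τ <;> simp [Ty.rename, Ty.erase, Idx.rename, Idx.renames, hT]
  exact Idx.rename_rename_comm hI _

theorem Ty.erase_subst {σI σ : ℕ → Idx} {σT : ℕ → Ty B} {tI tT uI uT : ℕ → ℕ}
    (hI : ∀ k, (σI k).rename tI = σ (uI k)) (hT : ∀ k, (σT k).erase tT tI = σ (uT k)) (τ : Ty B) :
    (τ.subst σI σT).erase tT tI = (τ.erase uT uI).subst σ := by
  cases τ with
  | var k => exact hT k
  | arr τ ι => exact Idx.subst_rename_comm hI ι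
  | _ => rfl

end Ty

section Erasure
variable {S : Sig.{u}}

theorem Expr.erasesIn_eq_map (ρT ρI : ℕ → ℕ) (es : List (Expr S)) :
    Expr.erasesIn ρT ρI es = es.map (Expr.eraseIn ρT ρI) := by
  induction es with
  | nil => rfl
  | cons e es ih => simp [Expr.erasesIn, ih]

theorem Atom.erasesIn_eq_map (ρT ρI : ℕ → ℕ) (as : List (Atom S)) :
    Atom.erasesIn ρT ρI as = as.map (Atom.eraseIn ρT ρI) := by
  induction as with
  | nil => rfl
  | cons a as ih => simp [Atom.erasesIn, ih]

theorem Ty.erase_renames {B : Type u} {ρI ρT ρ tI tT uI uT : ℕ → ℕ}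
    (hI : ∀ k, tI (ρI k) = ρ (uI k)) (hT : ∀ k, tT (ρT k) = ρ (uT k)) (τs : List (Ty B)) :
    (Ty.renames ρI ρT τs).map (Ty.erase tT tI) = Idx.renames ρ (τs.map (Ty.erase uT uI)) := by
  simp [Ty.renames_eq_map, Idx.renames_eq_map, Ty.erase_rename hI hT]

theorem Ty.erase_substs {B : Type u} {σI σ : ℕ → Idx} {σT : ℕ → Ty B} {tI tT uI uT : ℕ → ℕ}
    (hI : ∀ k, (σI k).rename tI = σ (uI k)) (hT : ∀ k, (σT k).erase tT tI = σ (uT k))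
    (τs : List (Ty B)) :
    (Ty.substs σI σT τs).map (Ty.erase tT tI) = Idx.substs σ (τs.map (Ty.erase uT uI)) := by
  simp [Ty.substs_eq_map, Idx.substs_eq_map, Ty.erase_subst hI hT]

theorem Ty.renames_length {B : Type u} (ρI ρT : ℕ → ℕ) (τs : List (Ty B)) :
    (Ty.renames ρI ρT τs).length = τs.length := by
  simp [Ty.renames_eq_map]

theorem Ty.substs_length {B : Type u} (σI : ℕ → Idx) (σT : ℕ → Ty B) (τs : List (Ty B)) :
    (Ty.substs σI σT τs).length = τs.length := by
  simp [Ty.substs_eq_map]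

mutual
-- One erased renaming `ρ` has to act correctly on the images of index variables and of type
-- variables: hence one commuting square for each. Arbitrary numberings are necessary, since every
-- binder of indices or types changes them.
theorem Expr.eraseIn_rename {ρI ρT ρ tI tT uI uT : ℕ → ℕ} (ρE : ℕ → ℕ)
    (hI : ∀ k, tI (ρI k) = ρ (uI k)) (hT : ∀ k, tT (ρT k) = ρ (uT k)) : ∀ e : Expr S,
    (e.rename ρI ρT ρE).eraseIn tT tI = (e.eraseIn uT uI).rename ρ ρE
  | .var x => rfl
  | .arr tag ns atoms => by
      simp [Expr.rename, Expr.eraseIn, EExpr.rename, Atom.erasesIn_renames ρE hI hT atoms]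
  | .frame tag ns cells => by
      simp [Expr.rename, Expr.eraseIn, EExpr.rename, Expr.erasesIn_renames ρE hI hT cells,
        Ty.erase_rename hI hT]
  | .app f ins out ι args tag => by
      simp [Expr.rename, Expr.eraseIn, EExpr.rename, Expr.eraseIn_rename ρE hI hT f,
        Expr.erasesIn_renames ρE hI hT args, Ty.erase_rename hI hT, Ty.erase_renames hI hT]
  | .tapp f τs tag => by
      simp [Expr.rename, Expr.eraseIn, EExpr.rename, Expr.eraseIn_rename ρE hI hT f,
        Ty.erase_rename hI hT, Ty.erase_renames hI hT]
  | .iapp f ιs tag => by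
      simp [Expr.rename, Expr.eraseIn, EExpr.rename, Expr.eraseIn_rename ρE hI hT f,
        Ty.erase_rename hI hT, Idx.renames_renames_comm hI]
  | .unbox n e body bodyTag => by
      simp [Expr.rename, Expr.eraseIn, EExpr.rename, Expr.eraseIn_rename ρE hI hT e,
        Ty.erase_rename hI hT, Expr.eraseIn_rename (ρ := liftR n ρ) (tT := fun k => tT k + n)
        (uT := fun k => uT k + n) (liftR 1 ρE) (liftR_comm n hI)
        (fun k => by rw [liftR_add, hT]) body]
theorem Atom.eraseIn_rename {ρI ρT ρ tI tT uI uT : ℕ → ℕ} (ρE : ℕ → ℕ)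
    (hI : ∀ k, tI (ρI k) = ρ (uI k)) (hT : ∀ k, tT (ρT k) = ρ (uT k)) : ∀ a : Atom S,
    (a.rename ρI ρT ρE).eraseIn tT tI = (a.eraseIn uT uI).rename ρ ρE
  | .base b => rfl
  | .op o => rfl
  | .lam τs body => by
      simp [Atom.rename, Atom.eraseIn, EAtom.rename, Ty.renames_length,
        Expr.eraseIn_rename (liftR τs.length ρE) hI hT body]
  -- A type binder is erased to an index binder. The roles are exchanged: the numbers of type
  -- variables are lifted, those of index variables are shifted past the new binder.
  | .tlam ks body => by
      simp [Atom.rename, Atom.eraseIn, EAtom.rename, Expr.eraseIn_rename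
        (ρ := liftR ks.length ρ) (tI := fun k => tI k + ks.length)
        (uI := fun k => uI k + ks.length) ρE (fun k => by rw [liftR_add, hI])
        (liftR_comm ks.length hT) body]
  | .ilam γs body => by
      simp [Atom.rename, Atom.eraseIn, EAtom.rename, Expr.eraseIn_rename
        (ρ := liftR γs.length ρ) (tT := fun k => tT k + γs.length)
        (uT := fun k => uT k + γs.length) ρE (liftR_comm γs.length hI)
        (fun k => by rw [liftR_add, hT]) body]
  | .box ιs e τ => by
      simp [Atom.rename, Atom.eraseIn, EAtom.rename, Expr.eraseIn_rename ρE hI hT e,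
        Idx.renames_renames_comm hI]
theorem Expr.erasesIn_renames {ρI ρT ρ tI tT uI uT : ℕ → ℕ} (ρE : ℕ → ℕ)
    (hI : ∀ k, tI (ρI k) = ρ (uI k)) (hT : ∀ k, tT (ρT k) = ρ (uT k)) : ∀ es : List (Expr S),
    Expr.erasesIn tT tI (Expr.renames ρI ρT ρE es) = EExpr.renames ρ ρE (Expr.erasesIn uT uI es)
  | [] => rfl
  | e :: es => by
      simp [Expr.renames, Expr.erasesIn, EExpr.renames, Expr.eraseIn_rename ρE hI hT e,
        Expr.erasesIn_renames ρE hI hT es]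
theorem Atom.erasesIn_renames {ρI ρT ρ tI tT uI uT : ℕ → ℕ} (ρE : ℕ → ℕ)
    (hI : ∀ k, tI (ρI k) = ρ (uI k)) (hT : ∀ k, tT (ρT k) = ρ (uT k)) : ∀ as : List (Atom S),
    Atom.erasesIn tT tI (Atom.renames ρI ρT ρE as) = EAtom.renames ρ ρE (Atom.erasesIn uT uI as)
  | [] => rfl
  | a :: as => by
      simp [Atom.renames, Atom.erasesIn, EAtom.renames, Atom.eraseIn_rename ρE hI hT a,
        Atom.erasesIn_renames ρE hI hT as]
end

-- Erasure commutes with substitution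

/-- The three parts of a substitution in explicit terms are mapped by erasure (to numbers of
variables given by `tT`, `tI` in the results and by `uT`, `uI` in the scope of the substitution) to
the substitution `σ`, `σE'` in erased terms. -/
structure ErasesTo (tT tI uT uI : ℕ → ℕ) (σI : ℕ → Idx) (σT : ℕ → Ty S.BaseTy)
    (σE : ℕ → Expr S) (σ : ℕ → Idx) (σE' : ℕ → EExpr S) : Prop where
  idx : ∀ k, (σI k).rename tI = σ (uI k)
  ty : ∀ k, (σT k).erase tT tI = σ (uT k)
  expr : ∀ k, (σE k).eraseIn tT tI = σE' k

variable {tT tI uT uI : ℕ → ℕ} {σI : ℕ → Idx} {σT : ℕ → Ty S.BaseTy} {σE : ℕ → Expr S}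
  {σ : ℕ → Idx} {σE' : ℕ → EExpr S}

theorem Expr.eraseIn_shiftEI (n : ℕ) (h : ∀ k, (σE k).eraseIn tT tI = σE' k) (k : ℕ) :
    (shiftEI n σE k).eraseIn (fun k => tT k + n) (liftR n tI) = shiftEE n σE' k := by
  rw [shiftEI, shiftEE, ← h]
  exact Expr.eraseIn_rename id (fun k => by exact liftR_add n tI k) (fun _ => by rfl) _

theorem Expr.eraseIn_shiftET (n : ℕ) (h : ∀ k, (σE k).eraseIn tT tI = σE' k) (k : ℕ) :
    (shiftET n σE k).eraseIn (liftR n tT) (fun k => tI k + n) = shiftEE n σE' k := by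
  rw [shiftET, shiftEE, ← h]
  exact Expr.eraseIn_rename id (fun _ => by rfl) (fun k => by exact liftR_add n tT k) _

theorem Expr.eraseIn_liftE (n : ℕ) (h : ∀ k, (σE k).eraseIn tT tI = σE' k) (k : ℕ) :
    (liftE n σE k).eraseIn tT tI = liftEE n σE' k := by
  unfold liftE liftEE
  split_ifs
  · rfl
  · rw [← h]
    exact Expr.eraseIn_rename _ (fun _ => by rfl) (fun _ => by rfl) _

theorem liftI_add (n : ℕ) (σ : ℕ → Idx) (k : ℕ) : liftI n σ (k + n) = (σ k).rename (· + n) := by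
  simp [liftI]

theorem ErasesTo.liftE (h : ErasesTo tT tI uT uI σI σT σE σ σE') (n : ℕ) :
    ErasesTo tT tI uT uI σI σT (liftE n σE) σ (liftEE n σE') :=
  ⟨h.idx, h.ty, Expr.eraseIn_liftE n h.expr⟩

theorem ErasesTo.liftI (h : ErasesTo tT tI uT uI σI σT σE σ σE') (n : ℕ) :
    ErasesTo (fun k => tT k + n) (liftR n tI) (fun k => uT k + n) (liftR n uI)
      (liftI n σI) (shiftTI n σT) (shiftEI n σE) (liftI n σ) (shiftEE n σE') where
  idx k := by
    by_cases hk : k < n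
    · simp [Remora.liftI, liftR, hk, Idx.rename]
    · simp only [Remora.liftI, liftR, hk, if_false, Nat.not_lt_of_le (Nat.le_add_left _ _),
        Nat.add_sub_cancel, ← h.idx]
      exact Idx.rename_rename_comm (liftR_add n tI) _
  ty k := by
    rw [liftI_add, shiftTI, ← h.ty]
    exact Ty.erase_rename (fun k => by exact liftR_add n tI k) (fun _ => by rfl) _
  expr := Expr.eraseIn_shiftEI n h.expr

/-- Below a binder of types the explicit index substitution is unchanged, but the erased one is
lifted, as the bound type variables have become index variables. The images of the free variables of
both sorts move up by `n`. -/
theorem ErasesTo.liftT (h : ErasesTo tT tI uT uI σI σT σE σ σE') (n : ℕ) :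
    ErasesTo (liftR n tT) (fun k => tI k + n) (liftR n uT) (fun k => uI k + n)
      σI (liftT n σT) (shiftET n σE) (Remora.liftI n σ) (shiftEE n σE') where
  idx k := by
    rw [liftI_add, ← h.idx, Idx.rename_rename]
  ty k := by
    by_cases hk : k < n
    · simp [Remora.liftI, Remora.liftT, liftR, hk, Ty.erase]
    · simp only [Remora.liftI, Remora.liftT, liftR, hk, if_false,
        Nat.not_lt_of_le (Nat.le_add_left _ _), Nat.add_sub_cancel, ← h.ty]
      exact Ty.erase_rename (fun _ => by rfl) (fun k => by exact liftR_add n tT k) _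
  expr := Expr.eraseIn_shiftET n h.expr

mutual
-- The invariant `ErasesTo` survives each kind of binder, so structural induction goes through. This
-- one statement serves β, tβ, iβ and unboxing.
theorem Expr.eraseIn_subst {tT tI uT uI : ℕ → ℕ} {σI : ℕ → Idx} {σT : ℕ → Ty S.BaseTy}
    {σE : ℕ → Expr S} {σ : ℕ → Idx} {σE' : ℕ → EExpr S}
    (h : ErasesTo tT tI uT uI σI σT σE σ σE') : ∀ e : Expr S,
    (e.subst σI σT σE).eraseIn tT tI = (e.eraseIn uT uI).subst σ σE'
  | .var x => h.expr x
  | .arr tag ns atoms => by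
      simp [Expr.subst, Expr.eraseIn, EExpr.subst, Atom.erasesIn_substs h atoms]
  | .frame tag ns cells => by
      simp [Expr.subst, Expr.eraseIn, EExpr.subst, Expr.erasesIn_substs h cells,
        Ty.erase_subst h.idx h.ty]
  | .app f ins out ι args tag => by
      simp [Expr.subst, Expr.eraseIn, EExpr.subst, Expr.eraseIn_subst h f,
        Expr.erasesIn_substs h args, Ty.erase_subst h.idx h.ty, Ty.erase_substs h.idx h.ty]
  | .tapp f τs tag => by
      simp [Expr.subst, Expr.eraseIn, EExpr.subst, Expr.eraseIn_subst h f,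
        Ty.erase_subst h.idx h.ty, Ty.erase_substs h.idx h.ty]
  | .iapp f ιs tag => by
      simp [Expr.subst, Expr.eraseIn, EExpr.subst, Expr.eraseIn_subst h f,
        Ty.erase_subst h.idx h.ty, Idx.substs_renames_comm h.idx]
  | .unbox n e body bodyTag => by
      simp [Expr.subst, Expr.eraseIn, EExpr.subst, Expr.eraseIn_subst h e,
        Ty.erase_subst h.idx h.ty, Expr.eraseIn_subst ((h.liftI n).liftE 1) body]
theorem Atom.eraseIn_subst {tT tI uT uI : ℕ → ℕ} {σI : ℕ → Idx} {σT : ℕ → Ty S.BaseTy}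
    {σE : ℕ → Expr S} {σ : ℕ → Idx} {σE' : ℕ → EExpr S}
    (h : ErasesTo tT tI uT uI σI σT σE σ σE') : ∀ a : Atom S,
    (a.subst σI σT σE).eraseIn tT tI = (a.eraseIn uT uI).subst σ σE'
  | .base b => rfl
  | .op o => rfl
  | .lam τs body => by
      simp [Atom.subst, Atom.eraseIn, EAtom.subst, Ty.substs_length,
        Expr.eraseIn_subst (h.liftE τs.length) body]
  | .tlam ks body => by
      simp [Atom.subst, Atom.eraseIn, EAtom.subst, Expr.eraseIn_subst (h.liftT ks.length) body]
  | .ilam γs body => by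
      simp [Atom.subst, Atom.eraseIn, EAtom.subst, Expr.eraseIn_subst (h.liftI γs.length) body]
  | .box ιs e τ => by
      simp [Atom.subst, Atom.eraseIn, EAtom.subst, Expr.eraseIn_subst h e,
        Idx.substs_renames_comm h.idx]
theorem Expr.erasesIn_substs {tT tI uT uI : ℕ → ℕ} {σI : ℕ → Idx} {σT : ℕ → Ty S.BaseTy}
    {σE : ℕ → Expr S} {σ : ℕ → Idx} {σE' : ℕ → EExpr S}
    (h : ErasesTo tT tI uT uI σI σT σE σ σE') : ∀ es : List (Expr S),
    Expr.erasesIn tT tI (Expr.substs σI σT σE es) = EExpr.substs σ σE' (Expr.erasesIn uT uI es)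
  | [] => rfl
  | e :: es => by
      simp [Expr.substs, Expr.erasesIn, EExpr.substs, Expr.eraseIn_subst h e,
        Expr.erasesIn_substs h es]
theorem Atom.erasesIn_substs {tT tI uT uI : ℕ → ℕ} {σI : ℕ → Idx} {σT : ℕ → Ty S.BaseTy}
    {σE : ℕ → Expr S} {σ : ℕ → Idx} {σE' : ℕ → EExpr S}
    (h : ErasesTo tT tI uT uI σI σT σE σ σE') : ∀ as : List (Atom S),
    Atom.erasesIn tT tI (Atom.substs σI σT σE as) = EAtom.substs σ σE' (Atom.erasesIn uT uI as)
  | [] => rfl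
  | a :: as => by
      simp [Atom.substs, Atom.erasesIn, EAtom.substs, Atom.eraseIn_subst h a,
        Atom.erasesIn_substs h as]
end

-- Instantiation of an outermost binder

/-- Erasure of atoms outside all binders, with the numbering of variables of `Expr.erase`. -/
def Atom.erase (a : Atom S) : EAtom S := a.eraseIn (fun k => 2 * k) (fun k => 2 * k + 1)

/-- Erasure of types outside all binders, with the numbering of variables of `Expr.erase`. -/
def Ty.erase₀ {B : Type u} (τ : Ty B) : Idx := τ.erase (fun k => 2 * k) (fun k => 2 * k + 1)

/-- Erasure of indices outside all binders, with the numbering of variables of `Expr.erase`. -/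
def Idx.erase (ι : Idx) : Idx := ι.rename (fun k => 2 * k + 1)

theorem Expr.erase_subst_instE (body : Expr S) (es : List (Expr S)) :
    (body.subst Idx.var Ty.var (instE es)).erase =
      body.erase.subst Idx.var (instEE (es.map Expr.erase)) := by
  refine Expr.eraseIn_subst ⟨fun _ => rfl, fun _ => rfl, fun k => ?_⟩ body
  unfold instE instEE
  by_cases hk : k < es.length
  · simp [hk, Expr.erase]
  · simp [List.getElem?_eq_none (not_lt.1 hk), Expr.eraseIn]

/-- In the scope of the binder the bound variables keep their numbers below `ιs.length`, and the
free ones have their odd numbers shifted past them; instantiation undoes exactly this shift. -/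
theorem Idx.rename_instI (ιs : List Idx) (k : ℕ) :
    (instI ιs k).rename (fun k => 2 * k + 1) =
      instI (ιs.map Idx.erase) (liftR ιs.length (fun k => 2 * k + 1) k) := by
  unfold instI liftR
  by_cases hk : k < ιs.length
  · simp [hk, Idx.erase]
  · simp [Idx.rename, hk]

/-- Handles the variables of the other sort: they are not bound by the binder, so their erased
numbers lie past it and come back unshifted. -/
theorem instI_add (ιs : List Idx) {n : ℕ} (hn : n = ιs.length) (k : ℕ) :
    instI ιs (k + n) = .var k := by
  simp [instI, hn]

theorem Ty.erase_instT {B : Type u} (τs : List (Ty B)) (k : ℕ) :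
    (instT τs k).erase (fun k => 2 * k) (fun k => 2 * k + 1) =
      instI (τs.map Ty.erase₀) (liftR τs.length (fun k => 2 * k) k) := by
  unfold instI instT liftR
  by_cases hk : k < τs.length
  · simp [hk, Ty.erase₀]
  · simp [Ty.erase, hk]

theorem Expr.erase_subst_instT (body : Expr S) (τs : List (Ty S.BaseTy)) :
    (body.subst Idx.var (instT τs) Expr.var).erase =
      (body.eraseIn (liftR τs.length fun k => 2 * k) (fun k => 2 * k + 1 + τs.length)).subst
        (instI (τs.map Ty.erase₀)) EExpr.var :=
  Expr.eraseIn_subst ⟨fun k => by exact (instI_add _ (by simp) _).symm, Ty.erase_instT τs,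
    fun _ => rfl⟩ body

theorem Expr.erase_subst_instI (body : Expr S) (ιs : List Idx) :
    (body.subst (instI ιs) Ty.var Expr.var).erase =
      (body.eraseIn (fun k => 2 * k + ιs.length) (liftR ιs.length fun k => 2 * k + 1)).subst
        (instI (ιs.map Idx.erase)) EExpr.var :=
  Expr.eraseIn_subst ⟨Idx.rename_instI ιs, fun k => by exact (instI_add _ (by simp) _).symm,
    fun _ => rfl⟩ body

theorem Expr.erase_subst_instI_instE (body v : Expr S) (ιs : List Idx) :
    (body.subst (instI ιs) Ty.var (instE [v])).erase =
      (body.eraseIn (fun k => 2 * k + ιs.length) (liftR ιs.length fun k => 2 * k + 1)).subst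
        (instI (ιs.map Idx.erase)) (instEE [v.erase]) :=
  Expr.eraseIn_subst ⟨Idx.rename_instI ιs, fun k => by exact (instI_add _ (by simp) _).symm,
    fun k => by cases k <;> rfl⟩ body

/-! ## Erasure and values -/

theorem Expr.isVal_arr {tag : Ty S.BaseTy} {ns : List ℕ} {atoms : List (Atom S)} :
    IsVal (.arr tag ns atoms) ↔ ∀ a ∈ atoms, IsAVal a :=
  ⟨fun | .arr h => h, .arr⟩

theorem EExpr.isVal_arr {ns : List ℕ} {atoms : List (EAtom S)} :
    EIsVal (.arr ns atoms) ↔ ∀ a ∈ atoms, EIsAVal a :=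
  ⟨fun | .arr h => h, .arr⟩

mutual
-- Being a value depends only on constructors and on the contents of boxes. Type abstractions become
-- index abstractions, and both are atomic values.
theorem Expr.isVal_eraseIn (ρT ρI : ℕ → ℕ) : ∀ e : Expr S, EIsVal (e.eraseIn ρT ρI) ↔ IsVal e
  | .arr tag ns atoms => by
      rw [Expr.eraseIn, EExpr.isVal_arr, Expr.isVal_arr, Atom.isAVal_erasesIn ρT ρI atoms]
  | .var _ => ⟨nofun, nofun⟩
  | .frame _ _ _ => ⟨nofun, nofun⟩
  | .app _ _ _ _ _ _ => ⟨nofun, nofun⟩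
  | .tapp _ _ _ => ⟨nofun, nofun⟩
  | .iapp _ _ _ => ⟨nofun, nofun⟩
  | .unbox _ _ _ _ => ⟨nofun, nofun⟩
theorem Atom.isAVal_eraseIn (ρT ρI : ℕ → ℕ) : ∀ a : Atom S, EIsAVal (a.eraseIn ρT ρI) ↔ IsAVal a
  | .base _ => ⟨fun _ => .base, fun _ => .base⟩
  | .op _ => ⟨fun _ => .op, fun _ => .op⟩
  | .lam _ _ => ⟨fun _ => .lam, fun _ => .lam⟩
  | .tlam _ _ => ⟨fun _ => .tlam, fun _ => .ilam⟩
  | .ilam _ _ => ⟨fun _ => .ilam, fun _ => .ilam⟩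
  | .box _ e _ =>
      ⟨fun | .box h => .box ((Expr.isVal_eraseIn ρT ρI e).1 h),
        fun | .box h => .box ((Expr.isVal_eraseIn ρT ρI e).2 h)⟩
theorem Atom.isAVal_erasesIn (ρT ρI : ℕ → ℕ) : ∀ as : List (Atom S),
    (∀ a ∈ Atom.erasesIn ρT ρI as, EIsAVal a) ↔ ∀ a ∈ as, IsAVal a
  | [] => by simp [Atom.erasesIn]
  | a :: as => by
      simp only [Atom.erasesIn, List.forall_mem_cons, Atom.isAVal_eraseIn ρT ρI a,
        Atom.isAVal_erasesIn ρT ρI as]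
end

theorem Expr.isVal_erase {e : Expr S} : EIsVal e.erase ↔ IsVal e := Expr.isVal_eraseIn _ _ e

theorem Atom.isAVal_erase {a : Atom S} : EIsAVal a.erase ↔ IsAVal a := Atom.isAVal_eraseIn _ _ a

end Erasure

/-! ## Lists -/

/-- Replication only moves atoms by position and never inspects them, so it commutes with erasure of
the atoms. -/
theorem replicateCells_map {α β : Type u} (f : α → β) (old new : List ℕ) (n : ℕ)
    (atoms : List α) :
    (replicateCells old new n atoms).map f = replicateCells old new n (atoms.map f) := by
  have h : ∀ j, (piece n atoms j).map f = piece n (atoms.map f) j := fun j => by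
    simp [piece, List.map_take, List.map_drop]
  simp only [replicateCells, rep, split, List.map_flatten, List.map_flatMap, List.flatMap_map,
    List.map_replicate, h]

/-- Brings a list whose elements all have a certain form into the shape `bs.map g` in which the
reduction rules are stated. -/
theorem exists_map_eq {α β : Type*} {g : β → α} {p : β → Prop} {l : List α}
    (h : ∀ a ∈ l, ∃ b, p b ∧ g b = a) : ∃ bs : List β, (∀ b ∈ bs, p b) ∧ bs.map g = l := by
  induction l with
  | nil => exact ⟨[], by simp, rfl⟩
  | cons a l ih =>
    obtain ⟨b, hb, rfl⟩ := h a (by simp)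
    obtain ⟨bs, hbs, rfl⟩ := ih fun a' h' => h a' (by simp [h'])
    exact ⟨b :: bs, by simpa using ⟨hb, hbs⟩, rfl⟩

theorem eq_of_map_eq_map {α β γ : Type*} {f : α → β} {g : α → γ} {l l' : List α}
    (h : ∀ a ∈ l, ∀ b ∈ l', f a = f b → g a = g b → a = b) (hf : l.map f = l'.map f)
    (hg : l.map g = l'.map g) : l = l' := by
  induction l generalizing l' with
  | nil => simpa using hf
  | cons a l ih =>
    cases l' with
    | nil => simp at hf
    | cons b l' =>
      simp only [List.map_cons, List.cons.injEq] at hf hg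
      rw [h a (by simp) b (by simp) hf.1 hg.1,
        ih (fun x hx y hy => h x (by simp [hx]) y (by simp [hy])) hf.2 hg.2]

theorem map_eq_map_of_forall₂ {α β γ : Type*} {f : α → γ} {g : β → γ} {l : List α} {l' : List β}
    (h : List.Forall₂ (fun a b => f a = g b) l l') : l.map f = l'.map g := by
  induction h with
  | nil => rfl
  | cons h _ ih => rw [List.map_cons, List.map_cons, h, ih]

-- Left-to-right evaluation of lists

/-- A step of the first element of a list which is not a value. -/
def ListStep {α : Type*} (val : α → Prop) (step : α → α → Prop) (l l' : List α) : Prop :=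
  ∃ vs x x' xs, l = vs ++ x :: xs ∧ l' = vs ++ x' :: xs ∧ (∀ v ∈ vs, val v) ∧ step x x'

/-- `x` and its image `er x` are both values, or both take a step so that the results correspond, or
are both stuck. -/
def Lock {α β : Type*} (val : α → Prop) (step : α → α → Prop) (val' : β → Prop)
    (step' : β → β → Prop) (er : α → β) (x : α) : Prop :=
  (val x ∧ val' (er x)) ∨ (∃ y, step x y ∧ step' (er x) (er y)) ∨
    ((¬ val x ∧ ¬ ∃ y, step x y) ∧ (¬ val' (er x) ∧ ¬ ∃ y, step' (er x) y))

theorem ListStep.cons_iff {α : Type*} {val : α → Prop} {step : α → α → Prop} {x : α}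
    {l : List α} :
    (∃ l', ListStep val step (x :: l) l') ↔
      (∃ y, step x y) ∨ (val x ∧ ∃ l', ListStep val step l l') := by
  constructor
  · rintro ⟨l', vs, z, z', xs, h, rfl, hv, hs⟩
    cases vs with
    | nil =>
      obtain ⟨rfl, rfl⟩ := List.cons.inj h
      exact .inl ⟨_, hs⟩
    | cons v vs =>
      obtain ⟨rfl, rfl⟩ := List.cons.inj h
      exact .inr ⟨hv _ (by simp), _, vs, z, z', xs, rfl, rfl, fun w hw => hv w (by simp [hw]), hs⟩
  · rintro (⟨y, hy⟩ | ⟨hx, _, vs, z, z', xs, rfl, rfl, hv, hs⟩)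
    · exact ⟨_, [], x, y, l, rfl, rfl, by simp, hy⟩
    · exact ⟨_, x :: vs, z, z', xs, rfl, rfl, by simpa using ⟨hx, hv⟩, hs⟩

theorem ListStep.not_of_val {α : Type*} {val : α → Prop} {step : α → α → Prop}
    (hval : ∀ x y, val x → ¬ step x y) {l : List α} (h : ∀ x ∈ l, val x) :
    ¬ ∃ l', ListStep val step l l' := by
  rintro ⟨l', vs, z, z', xs, rfl, rfl, -, hs⟩
  exact hval z z' (h z (by simp)) hs

/-- Evaluation passes over values and stops at the first element that is none, and erasure preserves
which element this is. The same statement covers the atoms of a literal, the cells of a frame and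
the arguments of an application. -/
theorem Lock.list {α β : Type*} {val : α → Prop} {step : α → α → Prop} {val' : β → Prop}
    {step' : β → β → Prop} {er : α → β} (hval : ∀ x y, val x → ¬ step x y)
    (hval' : ∀ x y, val' x → ¬ step' x y) {l : List α}
    (h : ∀ x ∈ l, Lock val step val' step' er x) :
    Lock (fun l => ∀ x ∈ l, val x) (ListStep val step) (fun l => ∀ x ∈ l, val' x)
      (ListStep val' step') (List.map er) l := by
  induction l with
  | nil => exact .inl ⟨by simp, by simp⟩
  | cons x l ih =>
    rcases h x (by simp) with ⟨h₁, h₁'⟩ | ⟨y, h₁, h₁'⟩ | ⟨⟨h₁, h₂⟩, h₁', h₂'⟩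
    · rcases ih fun y hy => h y (by simp [hy]) with ⟨h₂, h₂'⟩ | ⟨l', h₂, h₂'⟩ | ⟨⟨h₂, h₃⟩, h₂', h₃'⟩
      · exact .inl ⟨by simpa using ⟨h₁, h₂⟩, by simpa using ⟨h₁', by simpa using h₂'⟩⟩
      · refine .inr (.inl ⟨x :: l', ?_, ?_⟩)
        · obtain ⟨vs, z, z', xs, rfl, rfl, hv, hs⟩ := h₂
          exact ⟨x :: vs, z, z', xs, rfl, rfl, by simpa using ⟨h₁, hv⟩, hs⟩
        · obtain ⟨vs, z, z', xs, e, e', hv, hs⟩ := h₂'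
          exact ⟨er x :: vs, z, z', xs, by simp [e], by simp [e'],
            by simpa using ⟨h₁', hv⟩, hs⟩
      · refine .inr (.inr ⟨⟨fun h => h₂ fun y hy => h y (by simp [hy]), ?_⟩,
          fun h => h₂' fun y hy => h y (List.mem_cons_of_mem _ hy), ?_⟩)
        -- A step in the list would be a step of the head, impossible for a value, or a step in the
        -- tail, which is stuck.
        · rw [ListStep.cons_iff]
          rintro (⟨y, hy⟩ | ⟨-, hl⟩)
          exacts [hval _ _ h₁ hy, h₃ hl]
        · rw [List.map_cons, ListStep.cons_iff]
          rintro (⟨y, hy⟩ | ⟨-, hl⟩)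
          exacts [hval' _ _ h₁' hy, h₃' hl]
    · exact .inr (.inl ⟨y :: l, ⟨[], x, y, l, rfl, rfl, by simp, h₁⟩,
        [], er x, er y, l.map er, rfl, rfl, by simp, h₁'⟩)
    · refine .inr (.inr ⟨⟨fun h => h₁ (h x (by simp)), ?_⟩, fun h => h₁' (h (er x) (by simp)), ?_⟩)
      · rw [ListStep.cons_iff]
        rintro (h | ⟨h, -⟩)
        exacts [h₂ h, h₁ h]
      · rw [List.map_cons, ListStep.cons_iff]
        rintro (h | ⟨h, -⟩)
        exacts [h₂' h, h₁' h]

section Steps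
variable {S : Sig.{u}}

/-! ## Inversion of steps -/

/-- An array literal is never a redex. It can step only inside a box, whose contents are a value
already, so induction applies. -/
theorem IsVal.not_step {δ : S.Op → List (Expr S) → Option (Expr S)} (e e' : Expr S)
    (hv : IsVal e) : ¬ Step δ e e' := by
  intro h
  induction h with
  | red h => cases hv; cases h
  | box _ _ ih =>
    have h := Expr.isVal_arr.1 hv _ (List.mem_append_right _ (List.mem_cons_self))
    cases h with
    | box h => exact ih h
  | _ => cases hv

theorem EIsVal.not_step {δ : S.Op → List (EExpr S) → Option (EExpr S)} (e e' : EExpr S)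
    (hv : EIsVal e) : ¬ EStep δ e e' := by
  intro h
  induction h with
  | red h => cases hv; cases h
  | box _ _ ih =>
    have h := EExpr.isVal_arr.1 hv _ (List.mem_append_right _ (List.mem_cons_self))
    cases h with
    | box h => exact ih h
  | _ => cases hv

/-- A step of the contents of a box. -/
inductive AStep (δ : S.Op → List (Expr S) → Option (Expr S)) : Atom S → Atom S → Prop
  | box {ιs e e' τ} : Step δ e e' → AStep δ (.box ιs e τ) (.box ιs e' τ)

/-- A step of the contents of an erased box. -/
inductive EAStep (δ : S.Op → List (EExpr S) → Option (EExpr S)) : EAtom S → EAtom S → Prop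
  | box {ιs e e'} : EStep δ e e' → EAStep δ (.box ιs e) (.box ιs e')

theorem IsAVal.not_step {δ : S.Op → List (Expr S) → Option (Expr S)} (a a' : Atom S)
    (hv : IsAVal a) : ¬ AStep δ a a' := by
  rintro ⟨h⟩
  cases hv with
  | box hv => exact hv.not_step _ _ h

theorem EIsAVal.not_step {δ : S.Op → List (EExpr S) → Option (EExpr S)} (a a' : EAtom S)
    (hv : EIsAVal a) : ¬ EAStep δ a a' := by
  rintro ⟨h⟩
  cases hv with
  | box hv => exact hv.not_step _ _ h

theorem Step.arr_iff {δ : S.Op → List (Expr S) → Option (Expr S)} {tag : Ty S.BaseTy}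
    {ns : List ℕ} {atoms : List (Atom S)} {e' : Expr S} :
    Step δ (.arr tag ns atoms) e' ↔
      ∃ atoms', e' = .arr tag ns atoms' ∧ ListStep IsAVal (AStep δ) atoms atoms' := by
  constructor
  · intro h
    cases h with
    | red h => cases h
    | box hv h => exact ⟨_, rfl, _, _, _, _, rfl, rfl, hv, .box h⟩
  · rintro ⟨_, rfl, vs, _, _, as, rfl, rfl, hv, ⟨h⟩⟩
    exact .box hv h

theorem EStep.arr_iff {δ : S.Op → List (EExpr S) → Option (EExpr S)}
    {ns : List ℕ} {atoms : List (EAtom S)} {e' : EExpr S} :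
    EStep δ (.arr ns atoms) e' ↔
      ∃ atoms', e' = .arr ns atoms' ∧ ListStep EIsAVal (EAStep δ) atoms atoms' := by
  constructor
  · intro h
    cases h with
    | red h => cases h
    | box hv h => exact ⟨_, rfl, _, _, _, _, rfl, rfl, hv, .box h⟩
  · rintro ⟨_, rfl, vs, _, _, as, rfl, rfl, hv, ⟨h⟩⟩
    exact .box hv h

theorem Step.frame {δ : S.Op → List (Expr S) → Option (Expr S)} {tag : Ty S.BaseTy}
    {ns : List ℕ} {cells cells' : List (Expr S)} (h : ListStep IsVal (Step δ) cells cells') :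
    Step δ (.frame tag ns cells) (.frame tag ns cells') := by
  obtain ⟨vs, _, _, as, rfl, rfl, hv, h⟩ := h
  exact .cell hv h

theorem EStep.frame {δ : S.Op → List (EExpr S) → Option (EExpr S)} {ι : Idx}
    {cells cells' : List (EExpr S)} (h : ListStep EIsVal (EStep δ) cells cells') :
    EStep δ (.frame ι cells) (.frame ι cells') := by
  obtain ⟨vs, _, _, as, rfl, rfl, hv, h⟩ := h
  exact .cell hv h

/-- This inversion and the ones for the other forms only record that some step exists, not its
result: they serve to refute steps of stuck terms. -/
theorem Step.frame_inv {δ : S.Op → List (Expr S) → Option (Expr S)} {tag : Ty S.BaseTy}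
    {ns : List ℕ} {cells : List (Expr S)} {e' : Expr S} (h : Step δ (.frame tag ns cells) e') :
    (∀ c ∈ cells, IsVal c) ∨ ∃ cells', ListStep IsVal (Step δ) cells cells' := by
  cases h with
  | red h =>
    cases h with
    | collapse h _ =>
      simp only [List.forall_mem_map]
      exact .inl fun c hc => .arr (h c hc)
  | cell hv h => exact .inr ⟨_, _, _, _, _, rfl, rfl, hv, h⟩

theorem EStep.frame_inv {δ : S.Op → List (EExpr S) → Option (EExpr S)} {ι : Idx}
    {cells : List (EExpr S)} {e' : EExpr S} (h : EStep δ (.frame ι cells) e') :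
    (∀ c ∈ cells, EIsVal c) ∨ ∃ cells', ListStep EIsVal (EStep δ) cells cells' := by
  cases h with
  | red h =>
    cases h with
    | collapse h _ =>
      simp only [List.forall_mem_map]
      exact .inl fun c hc => .arr (h c hc)
  | cell hv h => exact .inr ⟨_, _, _, _, _, rfl, rfl, hv, h⟩

theorem Step.args {δ : S.Op → List (Expr S) → Option (Expr S)} {f : Expr S}
    {ins : List (Ty S.BaseTy)} {out tag : Ty S.BaseTy} {ι : Idx} {args args' : List (Expr S)}
    (hf : IsVal f) (h : ListStep IsVal (Step δ) args args') :
    Step δ (.app f ins out ι args tag) (.app f ins out ι args' tag) := by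
  obtain ⟨vs, _, _, as, rfl, rfl, hv, h⟩ := h
  exact .arg hf hv h

theorem EStep.args {δ : S.Op → List (EExpr S) → Option (EExpr S)} {f : EExpr S}
    {ιs : List Idx} {ι' : Idx} {args args' : List (EExpr S)}
    (hf : EIsVal f) (h : ListStep EIsVal (EStep δ) args args') :
    EStep δ (.app f args ιs ι') (.app f args' ιs ι') := by
  obtain ⟨vs, _, _, as, rfl, rfl, hv, h⟩ := h
  exact .arg hf hv h

theorem ArgLit.Ok.isVal {a : ArgLit S} (h : a.Ok) : IsVal a.toExpr := .arr h.2

theorem EArgLit.Ok.isVal {a : EArgLit S} (h : a.Ok) : EIsVal a.toExpr := .arr h.2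

theorem Red.app_isVal {δ : S.Op → List (Expr S) → Option (Expr S)} {f e' : Expr S}
    {ins : List (Ty S.BaseTy)} {out tag : Ty S.BaseTy} {ι : Idx} {args : List (Expr S)}
    (h : Red δ (.app f ins out ι args tag) e') : IsVal f ∧ ∀ a ∈ args, IsVal a := by
  cases h with
  | lift hf ha _ _ => exact ⟨.arr hf, List.forall_mem_map.2 fun a h => (ha a h).isVal⟩
  | map hf ha _ _ _ => exact ⟨.arr hf, List.forall_mem_map.2 fun a h => (ha a h).isVal⟩
  | beta ha _ =>
    exact ⟨.arr (by simpa using .lam), List.forall_mem_map.2 fun a h => (ha a h).1.isVal⟩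
  | delta ha _ =>
    exact ⟨.arr (by simpa using .op), List.forall_mem_map.2 fun a h => (ha a h).1.isVal⟩

theorem ERed.app_isVal {δ : S.Op → List (EExpr S) → Option (EExpr S)} {f e' : EExpr S}
    {ιs : List Idx} {ι' : Idx} {args : List (EExpr S)}
    (h : ERed δ (.app f args ιs ι') e') : EIsVal f ∧ ∀ a ∈ args, EIsVal a := by
  cases h with
  | lift hf ha _ _ => exact ⟨.arr hf, List.forall_mem_map.2 fun a h => (ha a h).isVal⟩
  | map hf ha _ _ _ => exact ⟨.arr hf, List.forall_mem_map.2 fun a h => (ha a h).isVal⟩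
  | beta ha _ =>
    exact ⟨.arr (by simpa using .lam), List.forall_mem_map.2 fun a h => (ha a h).1.isVal⟩
  | delta ha _ =>
    exact ⟨.arr (by simpa using .op), List.forall_mem_map.2 fun a h => (ha a h).1.isVal⟩

theorem Step.app_inv {δ : S.Op → List (Expr S) → Option (Expr S)} {f e' : Expr S}
    {ins : List (Ty S.BaseTy)} {out tag : Ty S.BaseTy} {ι : Idx} {args : List (Expr S)}
    (h : Step δ (.app f ins out ι args tag) e') :
    (∃ f', Step δ f f') ∨ (IsVal f ∧ ∃ args', ListStep IsVal (Step δ) args args') ∨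
      (IsVal f ∧ (∀ a ∈ args, IsVal a) ∧ ∃ e', Red δ (.app f ins out ι args tag) e') := by
  cases h with
  | red h => exact .inr (.inr ⟨h.app_isVal.1, h.app_isVal.2, _, h⟩)
  | fn h => exact .inl ⟨_, h⟩
  | arg hf hv h => exact .inr (.inl ⟨hf, _, _, _, _, _, rfl, rfl, hv, h⟩)

theorem EStep.app_inv {δ : S.Op → List (EExpr S) → Option (EExpr S)} {f e' : EExpr S}
    {ιs : List Idx} {ι' : Idx} {args : List (EExpr S)}
    (h : EStep δ (.app f args ιs ι') e') :
    (∃ f', EStep δ f f') ∨ (EIsVal f ∧ ∃ args', ListStep EIsVal (EStep δ) args args') ∨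
      (EIsVal f ∧ (∀ a ∈ args, EIsVal a) ∧ ∃ e', ERed δ (.app f args ιs ι') e') := by
  cases h with
  | red h => exact .inr (.inr ⟨h.app_isVal.1, h.app_isVal.2, _, h⟩)
  | fn h => exact .inl ⟨_, h⟩
  | arg hf hv h => exact .inr (.inl ⟨hf, _, _, _, _, _, rfl, rfl, hv, h⟩)

theorem Step.tapp_inv {δ : S.Op → List (Expr S) → Option (Expr S)} {f e' : Expr S}
    {τs : List (Ty S.BaseTy)} {tag : Ty S.BaseTy} (h : Step δ (.tapp f τs tag) e') :
    (∃ f', Step δ f f') ∨ (IsVal f ∧ ∃ e', Red δ (.tapp f τs tag) e') := by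
  cases h with
  | red h =>
    refine .inr ⟨?_, _, h⟩
    cases h
    exact .arr (List.forall_mem_map.2 fun _ _ => .tlam)
  | tapp h => exact .inl ⟨_, h⟩

theorem Step.iapp_inv {δ : S.Op → List (Expr S) → Option (Expr S)} {f e' : Expr S}
    {ιs : List Idx} {tag : Ty S.BaseTy} (h : Step δ (.iapp f ιs tag) e') :
    (∃ f', Step δ f f') ∨ (IsVal f ∧ ∃ e', Red δ (.iapp f ιs tag) e') := by
  cases h with
  | red h =>
    refine .inr ⟨?_, _, h⟩
    cases h
    exact .arr (List.forall_mem_map.2 fun _ _ => .ilam)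
  | iapp h => exact .inl ⟨_, h⟩

theorem EStep.iapp_inv {δ : S.Op → List (EExpr S) → Option (EExpr S)} {f e' : EExpr S}
    {ιs : List Idx} {ι' : Idx} (h : EStep δ (.iapp f ιs ι') e') :
    (∃ f', EStep δ f f') ∨ (EIsVal f ∧ ∃ e', ERed δ (.iapp f ιs ι') e') := by
  cases h with
  | red h =>
    refine .inr ⟨?_, _, h⟩
    cases h
    exact .arr (List.forall_mem_map.2 fun _ _ => .ilam)
  | iapp h => exact .inl ⟨_, h⟩

theorem Step.unbox_inv {δ : S.Op → List (Expr S) → Option (Expr S)} {e body e' : Expr S}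
    {n : ℕ} {tag : Ty S.BaseTy} (h : Step δ (.unbox n e body tag) e') :
    (∃ f', Step δ e f') ∨ (IsVal e ∧ ∃ e', Red δ (.unbox n e body tag) e') := by
  cases h with
  | red h =>
    refine .inr ⟨?_, _, h⟩
    cases h with
    | unbox hb => exact .arr (List.forall_mem_map.2 fun b hb' => .box (hb b hb').2)
  | unbox h => exact .inl ⟨_, h⟩

theorem EStep.unbox_inv {δ : S.Op → List (EExpr S) → Option (EExpr S)} {e body e' : EExpr S}
    {n : ℕ} {ι : Idx} (h : EStep δ (.unbox n e body ι) e') :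
    (∃ f', EStep δ e f') ∨ (EIsVal e ∧ ∃ e', ERed δ (.unbox n e body ι) e') := by
  cases h with
  | red h =>
    refine .inr ⟨?_, _, h⟩
    cases h with
    | unbox hb => exact .arr (List.forall_mem_map.2 fun b hb' => .box (hb b hb').2)
  | unbox h => exact .inl ⟨_, h⟩

end Steps

section Lockstep
variable {S : Sig.{u}}

/-! ## Erasure outside all binders -/

theorem Expr.erase_arr (tag : Ty S.BaseTy) (ns : List ℕ) (atoms : List (Atom S)) :
    (Expr.arr tag ns atoms).erase = .arr ns (atoms.map Atom.erase) := by
  simp [Expr.erase, Expr.eraseIn, Atom.erasesIn_eq_map, Atom.erase]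

theorem Expr.erase_frame (tag : Ty S.BaseTy) (ns : List ℕ) (cells : List (Expr S)) :
    (Expr.frame tag ns cells).erase = .frame tag.erase₀ (cells.map Expr.erase) := by
  simp [Expr.erase, Expr.eraseIn, Expr.erasesIn_eq_map, Ty.erase₀]

theorem Expr.erase_app (f : Expr S) (ins : List (Ty S.BaseTy)) (out tag : Ty S.BaseTy) (ι : Idx)
    (args : List (Expr S)) :
    (Expr.app f ins out ι args tag).erase =
      .app f.erase (args.map Expr.erase) (ins.map Ty.erase₀) tag.erase₀ := by
  simp [Expr.erase, Expr.eraseIn, Expr.erasesIn_eq_map, Ty.erase₀]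

theorem Expr.erase_tapp (f : Expr S) (τs : List (Ty S.BaseTy)) (tag : Ty S.BaseTy) :
    (Expr.tapp f τs tag).erase = .iapp f.erase (τs.map Ty.erase₀) tag.erase₀ := rfl

theorem Expr.erase_iapp (f : Expr S) (ιs : List Idx) (tag : Ty S.BaseTy) :
    (Expr.iapp f ιs tag).erase = .iapp f.erase (ιs.map Idx.erase) tag.erase₀ := by
  simp [Expr.erase, Expr.eraseIn, Idx.renames_eq_map, Idx.erase, Ty.erase₀]

theorem Expr.erase_unbox (n : ℕ) (e body : Expr S) (tag : Ty S.BaseTy) :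
    (Expr.unbox n e body tag).erase =
      .unbox n e.erase (body.eraseIn (fun k => 2 * k + n) (liftR n fun k => 2 * k + 1))
        tag.erase₀ := rfl

theorem Atom.erase_box (ιs : List Idx) (e : Expr S) (τ : Ty S.BaseTy) :
    (Atom.box ιs e τ).erase = .box (ιs.map Idx.erase) e.erase := by
  simp [Atom.erase, Atom.eraseIn, Idx.renames_eq_map, Idx.erase, Expr.erase]

theorem Idx.dims?_erase (ι : Idx) : ι.erase.dims? = ι.dims? := Idx.dims?_rename _ _

/-- Erasure of an argument. -/
def ArgLit.erase (a : ArgLit S) : EArgLit S := ⟨a.ι.erase, a.frame, a.cell, a.atoms.map Atom.erase⟩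

theorem ArgLit.erase_toExpr (a : ArgLit S) : a.toExpr.erase = a.erase.toExpr :=
  Expr.erase_arr _ _ _

theorem ArgLit.erase_lifted (np : List ℕ) (a : ArgLit S) :
    (a.lifted np).erase = a.erase.lifted np := by
  simp [ArgLit.lifted, Expr.erase_arr, replicateCells_map, EArgLit.lifted, ArgLit.erase]

theorem ArgLit.erase_nthCell (j : ℕ) (a : ArgLit S) :
    (a.nthCell j).erase = a.erase.nthCell j := by
  simp [ArgLit.nthCell, Expr.erase_arr, EArgLit.nthCell, ArgLit.erase, piece]

theorem ArgLit.Ok.erase {a : ArgLit S} (h : a.Ok) : a.erase.Ok :=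
  ⟨(Idx.dims?_erase _).trans h.1, List.forall_mem_map.2 fun x hx => Atom.isAVal_erase.2 (h.2 x hx)⟩

theorem ArgLit.map_erase_toExpr (as : List (ArgLit S)) :
    (as.map ArgLit.toExpr).map Expr.erase = (as.map ArgLit.erase).map EArgLit.toExpr := by
  simp [ArgLit.erase_toExpr]

theorem ArgLit.map_erase_inTy (as : List (ArgLit S)) :
    (as.map ArgLit.inTy).map Ty.erase₀ = (as.map ArgLit.erase).map EArgLit.ι := by
  simp [ArgLit.inTy, Ty.erase₀, ArgLit.erase, Ty.erase, Idx.erase]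

/-- The index of the input type determines the cell shape, and cancelling it from the end of the
literal's shape leaves the frame. So a term matches the pattern of an application rule with at most
one list of arguments. -/
theorem ArgLit.eq_of_ok {as as' : List (ArgLit S)} (h : ∀ a ∈ as, a.Ok) (h' : ∀ a ∈ as', a.Ok)
    (h₁ : as.map ArgLit.inTy = as'.map ArgLit.inTy)
    (h₂ : as.map ArgLit.toExpr = as'.map ArgLit.toExpr) : as = as' := by
  refine eq_of_map_eq_map (fun a ha b hb e₁ e₂ => ?_) h₁ h₂
  have h₃ := (h a ha).1
  have h₄ := (h' b hb).1
  cases a; cases b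
  simp_all [ArgLit.inTy, ArgLit.toExpr]

theorem EArgLit.eq_of_ok {as as' : List (EArgLit S)} (h : ∀ a ∈ as, a.Ok)
    (h' : ∀ a ∈ as', a.Ok) (h₁ : as.map EArgLit.ι = as'.map EArgLit.ι)
    (h₂ : as.map EArgLit.toExpr = as'.map EArgLit.toExpr) : as = as' := by
  refine eq_of_map_eq_map (fun a ha b hb e₁ e₂ => ?_) h₁ h₂
  have h₃ := (h a ha).1
  have h₄ := (h' b hb).1
  cases a; cases b
  simp_all [EArgLit.toExpr]

/-! ## Redexes -/

/-- Either both terms are redexes with corresponding contracta, or neither is a redex. -/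
def RedLock (P : Prims S) (e : Expr S) : Prop :=
  (∃ e', Red P.delta e e' ∧ ERed P.edelta e.erase e'.erase) ∨
    (¬ (∃ e', Red P.delta e e') ∧ ¬ ∃ e', ERed P.edelta e.erase e')

theorem isVal_inv {e : Expr S} (h : IsVal e) :
    ∃ tag ns atoms, e = .arr tag ns atoms ∧ ∀ a ∈ atoms, IsAVal a := by
  cases h with
  | arr h => exact ⟨_, _, _, rfl, h⟩

theorem exists_argLits {args : List (Expr S)} {ps : List (Param S.BaseTy)}
    (hv : ∀ a ∈ args, IsVal a)
    (ht : List.Forall₂ (fun a p => HasTy [] [] [] a p.argTy) args ps) :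
    ∃ as : List (ArgLit S), as.map ArgLit.toExpr = args ∧
      as.map ArgLit.inTy = ps.map Param.inTy ∧ (∀ a ∈ as, a.Ok) ∧
      List.Forall₂ (fun (p : Param S.BaseTy) a => p.frame.dims? = some a.frame) ps
        as := by
  induction ht with
  | nil => exact ⟨[], rfl, rfl, by simp, .nil⟩
  | @cons e p args ps h _ ih =>
    obtain ⟨as, rfl, h₁, h₂, h₃⟩ := ih fun a ha => hv a (by simp [ha])
    obtain ⟨tag, ns, atoms, rfl, ha⟩ := isVal_inv (hv e (by simp))
    -- The argument's type has the shape `(++ frame cell)`; evaluating it splits the literal's shape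
    -- into the frame `n` and the cell shape `n'`.
    obtain ⟨n, n', h₄, h₅, rfl⟩ := Idx.dims?_append.1 h.arr_arr_inv.1
    exact ⟨⟨p.elem, p.cell, tag, n, n', atoms⟩ :: as, rfl, by rw [List.map_cons, h₁]; rfl,
      by simpa using ⟨⟨h₅, ha⟩, h₂⟩, .cons h₄ h₃⟩

/-- The indices of the typing rule and the frames of the literals denote the same list of sequences,
and the prefix order on closed indices gives the prefix order on what they denote. -/
theorem IsMaxIdx.dims? {ps : List (Param S.BaseTy)} {as : List (ArgLit S)} {ιf ιp : Idx}
    {nf : List ℕ} (h : IsMaxIdx [] (ιf :: ps.map Param.frame) ιp) (hf : ιf.dims? = some nf)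
    (ha : List.Forall₂ (fun (p : Param S.BaseTy) a => p.frame.dims? = some (ArgLit.frame a))
      ps as) :
    ∃ np, ιp.dims? = some np ∧ IsMaxFrame (nf :: as.map ArgLit.frame) np := by
  have hd : (ιf :: ps.map Param.frame).map Idx.dims? =
      (nf :: as.map ArgLit.frame).map some := by
    rw [List.map_cons, List.map_cons, hf, List.map_map, List.map_map]
    congr 1
    exact map_eq_map_of_forall₂ ha
  obtain ⟨np, hnp, hp⟩ : ∃ np ∈ nf :: as.map ArgLit.frame, some np = ιp.dims? := by
    rw [← List.mem_map, ← hd]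
    exact List.mem_map_of_mem h.1
  refine ⟨np, hp.symm, hnp, fun d hd' => ?_⟩
  have : some d ∈ (ιf :: ps.map Param.frame).map Idx.dims? := hd ▸ List.mem_map_of_mem hd'
  obtain ⟨ι, hι, hιd⟩ := List.mem_map.1 this
  obtain ⟨d', h₁, h₂⟩ := (h.2 ι hι).dims? hp.symm
  rw [hιd] at h₁
  cases h₁
  exact h₂

/-- Where all frames are empty, the arguments have the input types of the function. -/
theorem hasTy_inputs {args : List (Expr S)} {ps : List (Param S.BaseTy)}
    {τs : List (Ty S.BaseTy)}
    (ht : List.Forall₂ (fun a p => HasTy [] [] [] a p.argTy) args ps)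
    (hτ : List.Forall₂ (TEqv []) (ps.map Param.inTy) τs)
    (hp : ∀ p ∈ ps, p.frame.dims? = some [] ∧ HasSort [] p.frame .shape ∧
      HasSort [] p.cell .shape) :
    List.Forall₂ (HasTy [] [] []) args τs := by
  induction ht generalizing τs with
  | nil => cases hτ; exact .nil
  | @cons e p args ps h _ ih =>
    cases hτ with
    | cons h₁ h₂ =>
      obtain ⟨h₃, h₄, h₅⟩ := hp p (by simp)
      refine .cons (.eqv h (h₁.symm.trans (.arr .refl ?_)))
        (ih h₂ fun q hq => hp q (by simp [hq]))
      obtain ⟨ns, hns⟩ := h₅.dims?_isSome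
      exact .of_dims? h₅ (HasSort.append_pair.2 ⟨h₄, h₅⟩) hns
        (Idx.dims?_append.2 ⟨_, _, h₃, hns, rfl⟩)

/-- The greatest frame required by the typing rule makes lift applicable whenever the frames differ.
With equal frames, map, β or δ remain according to whether the frame is empty and to the form of the
single function. -/
theorem redLock_app (P : Prims S) {f : Expr S} {ps : List (Param S.BaseTy)}
    {τo tag : Ty S.BaseTy} {ιo ιf ιp : Idx} {args : List (Expr S)}
    (hf : HasTy [] [] [] f (.arr (.fn (ps.map Param.inTy) (.arr τo ιo)) ιf))
    (ht : List.Forall₂ (fun a p => HasTy [] [] [] a p.argTy) args ps)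
    (hmax : IsMaxIdx [] (ιf :: ps.map Param.frame) ιp)
    (htag : TEqv [] tag (.arr τo (.append [ιp, ιo])))
    (hfv : IsVal f) (hv : ∀ a ∈ args, IsVal a) :
    RedLock P (.app f (ps.map Param.inTy) (.arr τo ιo) ιf args tag) := by
  obtain ⟨ftag, nf, fs, rfl, hfs⟩ := isVal_inv hfv
  obtain ⟨hnf, hfty, hk, hlen⟩ := hf.arr_arr_inv
  obtain ⟨as, rfl, hin, hok, hfr⟩ := exists_argLits hv ht
  obtain ⟨np, hnp, hmaxf⟩ := hmax.dims? hnf hfr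
  have hfs' : ∀ x ∈ fs.map Atom.erase, EIsAVal x :=
    List.forall_mem_map.2 fun x hx => Atom.isAVal_erase.2 (hfs x hx)
  have hok' : ∀ a ∈ as.map ArgLit.erase, a.Ok := List.forall_mem_map.2 fun a ha => (hok a ha).erase
  have hfrm : (as.map ArgLit.erase).map EArgLit.frame = as.map ArgLit.frame := by
    simp [ArgLit.erase]
  rw [RedLock, Expr.erase_app, Expr.erase_arr, ← hin, ArgLit.map_erase_toExpr,
    ArgLit.map_erase_inTy]
  by_cases hne : ∃ d ∈ nf :: as.map ArgLit.frame, d ≠ np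
  · refine .inl ⟨_, .lift hfs hok hmaxf hne, ?_⟩
    have := ERed.lift (δ := P.edelta) (ι' := tag.erase₀) hfs' hok' (by rwa [hfrm]) (by rwa [hfrm])
    convert this using 1
    rw [Expr.erase_app, Expr.erase_arr, replicateCells_map, ArgLit.map_erase_inTy]
    simp [ArgLit.erase_lifted, Function.comp_def]
  · push Not at hne
    obtain rfl : nf = np := hne nf (by simp)
    have hfra : ∀ a ∈ as, a.frame = nf := fun a ha =>
      hne _ (List.mem_cons_of_mem _ (List.mem_map_of_mem ha))
    -- The application rule has no kinding premise. The function literal supplies it, as the element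
    -- type of a well-typed literal is well-kinded.
    have hsorts : HasSort [] ιo .shape ∧ ∀ p ∈ ps, HasSort [] p.cell .shape := by
      cases hk with
      | fn h₁ h₂ =>
        constructor
        · cases h₂; assumption
        · intro p hp
          have := h₁ _ (List.mem_map_of_mem hp)
          rw [Param.inTy] at this
          cases this; assumption
    by_cases hnil : nf = []
    · subst hnil
      obtain ⟨f, rfl⟩ : ∃ f, fs = [f] := List.length_eq_one_iff.1 (by simpa using hlen)
      have hoka : ∀ a ∈ as, a.Ok ∧ a.frame = [] := fun a ha => ⟨hok a ha, hfra a ha⟩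
      have hoka' : ∀ a ∈ as.map ArgLit.erase, a.Ok ∧ a.frame = [] :=
        List.forall_mem_map.2 fun a ha => ⟨(hok a ha).erase, hfra a ha⟩
      rcases (hfty f (by simp)).of_fn with ⟨τs, body, rfl, hl⟩ | ⟨o, τs, τ, rfl, ho, hτs⟩
      · have hl' : τs.length = as.length := by
          rw [hl, ← List.length_map (f := ArgLit.inTy), hin]
        refine .inl ⟨_, .beta hoka hl', ?_⟩
        rw [Expr.erase_subst_instE, ArgLit.map_erase_toExpr]
        exact .beta hoka' (by simpa using hl')
      · have hps : ∀ p ∈ ps, p.frame.dims? = some [] := fun p hp => by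
          have h := List.mem_map_of_mem (f := fun p : Param S.BaseTy => p.frame.dims?) hp
          rw [map_eq_map_of_forall₂ hfr] at h
          obtain ⟨a, ha, h⟩ := List.mem_map.1 h
          rw [← h, hfra a ha]
        -- All frames are empty, so the arguments can be converted to the declared input types of
        -- the operator, as the agreement requires.
        have hagree := P.agree o τs τ (as.map ArgLit.toExpr) ho hv
          (hasTy_inputs ht hτs fun p hp => ⟨hps p hp,
            (hmax.2 _ (List.mem_cons_of_mem _ (List.mem_map_of_mem hp))).hasSort, hsorts.2 p hp⟩)
        rw [ArgLit.map_erase_toExpr] at hagree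
        cases hδ : P.delta o (as.map ArgLit.toExpr) with
        | some v =>
          rw [hδ] at hagree
          exact .inl ⟨v, .delta hoka hδ, .delta hoka' hagree⟩
        | none =>
          rw [hδ] at hagree
          refine .inr ⟨?_, ?_⟩
          · rintro ⟨e', h⟩
            -- Case analysis cannot unify two lists that are both images under `map`. The term is
            -- therefore abstracted, and each rule is refuted from the equation `hx`.
            generalize hx : Expr.app (Expr.arr ftag [] [Atom.op o]) (as.map ArgLit.inTy)
              (.arr τo ιo) ιf (as.map ArgLit.toExpr) tag = x at h
            cases h with
            | lift _ ha hm hd =>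
              injection hx with h₁ h₂ h₃ h₄ h₅ h₆
              injection h₁ with h₁ h₇ h₈
              -- By uniqueness of the splitting, the frames of the supposed lift are the known ones;
              -- these are all empty, so there is nothing to lift.
              obtain rfl := ArgLit.eq_of_ok hok ha h₂ h₅
              subst h₇
              have hall : ∀ d ∈ [] :: as.map ArgLit.frame, d = [] := by simpa using hfra
              obtain ⟨d, hd, hd'⟩ := hd
              exact hd' ((hall d hd).trans (hall _ hm.1).symm)
            | map _ _ hn _ _ =>
              injection hx with h₁
              injection h₁ with h₁ h₇ h₈
              exact hn h₇.symm
            | beta => simp at hx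
            | delta ha hd =>
              simp only [Expr.app.injEq, Expr.arr.injEq, List.cons.injEq, Atom.op.injEq] at hx
              rw [← hx.1.2.2.1, ← hx.2.2.2.2.1, hδ] at hd
              cases hd
            | _ => cases hx
          · rintro ⟨e', h⟩
            generalize hx : EExpr.app (.arr [] ([Atom.op o].map Atom.erase))
              ((as.map ArgLit.erase).map EArgLit.toExpr) ((as.map ArgLit.erase).map EArgLit.ι)
              tag.erase₀ = x at h
            cases h with
            | lift _ ha hm hd =>
              injection hx with h₁ h₂ h₃ h₄
              injection h₁ with h₁ h₅
              obtain rfl := EArgLit.eq_of_ok hok' ha h₃ h₂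
              subst h₁
              rw [hfrm] at hm hd
              have hall : ∀ d ∈ [] :: as.map ArgLit.frame, d = [] := by simpa using hfra
              obtain ⟨d, hd, hd'⟩ := hd
              exact hd' ((hall d hd).trans (hall _ hm.1).symm)
            | map _ _ hn _ _ =>
              injection hx with h₁
              injection h₁ with h₁
              exact hn h₁.symm
            | beta => simp [Atom.erase, Atom.eraseIn] at hx
            | delta ha hd =>
              simp only [EExpr.app.injEq, EExpr.arr.injEq, List.map_cons, List.cons.injEq,
                Atom.erase, Atom.eraseIn, EAtom.op.injEq] at hx
              rw [← hx.1.2.1, ← hx.2.1, hagree] at hd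
              cases hd
            | _ => cases hx
    · obtain ⟨no, hno⟩ := hsorts.1.dims?_isSome
      obtain ⟨τ, ιr, rfl, -, hιr⟩ := htag.exists_arr
      rw [Idx.dims?_append.2 ⟨_, _, hnp, hno, rfl⟩] at hιr
      refine .inl ⟨_, .map hfs hok hnil hfra hιr, ?_⟩
      have := ERed.map (δ := P.edelta) (ι' := ιr.erase) (no := no) hfs' hok' hnil
        (List.forall_mem_map.2 hfra) (by rwa [Idx.dims?_erase])
      convert this using 1
      · rfl
      rw [Expr.erase_frame]
      congr 1
      refine List.ext_getElem (by simp) fun j _ _ => ?_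
      simp only [List.getElem_map, List.getElem_mapIdx]
      rw [Expr.erase_app, Expr.erase_arr, ArgLit.map_erase_inTy, Ty.erase₀, Ty.erase,
        Idx.rename_lits]
      simp [ArgLit.erase_nthCell, Function.comp_def]

/-- There is no failing case here: all cells have the same array type, hence literal cells have
equal shapes and the frame collapses. -/
theorem redLock_frame (P : Prims S) {cells : List (Expr S)} {tag τ : Ty S.BaseTy} {ns : List ℕ}
    {ι : Idx} (ht : ∀ e ∈ cells, HasTy [] [] [] e (.arr τ ι)) (hk : HasKind [] [] (.arr τ ι) .array)
    (htag : TEqv [] tag (.arr τ (.append [Idx.lits ns, ι]))) (hv : ∀ e ∈ cells, IsVal e) :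
    ∃ e', Red P.delta (.frame tag ns cells) e' ∧
      ERed P.edelta (Expr.frame tag ns cells).erase e'.erase := by
  obtain ⟨τ', ι', rfl, -, hι'⟩ := htag.exists_arr
  -- The cell shape is read off the common type and not off a cell, since the frame may have no
  -- cells.
  obtain ⟨nc, hnc⟩ : ∃ nc, ι.dims? = some nc := by
    cases hk with
    | arr _ h => exact h.dims?_isSome
  rw [Idx.dims?_append.2 ⟨_, _, Idx.dims?_lits ns, hnc, rfl⟩] at hι'
  obtain ⟨cs, hcs, rfl⟩ : ∃ cs : List (Ty S.BaseTy × List (Atom S)),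
      (∀ c ∈ cs, ∀ x ∈ c.2, IsAVal x) ∧ cs.map (fun c => .arr c.1 nc c.2) = cells := by
    refine exists_map_eq fun e he => ?_
    obtain ⟨tag, ns', atoms, rfl, ha⟩ := isVal_inv (hv e he)
    have := (ht _ he).arr_arr_inv.1
    rw [hnc] at this
    cases this
    exact ⟨(tag, atoms), ha, rfl⟩
  refine ⟨_, .collapse hcs hι', ?_⟩
  -- An erased frame does not store `ns`. The erased rule accepts any factorization of the result
  -- shape, and the explicit one is supplied.
  have := ERed.collapse (δ := P.edelta) (ι := ι'.erase) (ns := ns) (nc := nc)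
    (cs := cs.map fun c => c.2.map Atom.erase)
    (List.forall_mem_map.2 fun c hc => List.forall_mem_map.2 fun x hx =>
      Atom.isAVal_erase.2 (hcs c hc x hx)) (by rwa [Idx.dims?_erase])
  convert this using 1
  · rw [Expr.erase_frame]
    simp [Ty.erase₀, Ty.erase, Idx.erase, Expr.erase_arr]
  · rw [Expr.erase_arr, List.map_flatMap, List.flatMap_def]

/-- Erasure no longer distinguishes type from index abstractions, so the erased rule could fire on
more arrays. Typing leaves only type abstractions over `ks` and operators. -/
theorem redLock_tapp (P : Prims S) {f : Expr S} {τs : List (Ty S.BaseTy)} {tag τ : Ty S.BaseTy}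
    {ks : List Knd} {ιf : Idx} (hf : HasTy [] [] [] f (.arr (.univ ks τ) ιf))
    (hl : ks.length = τs.length) (hfv : IsVal f) : RedLock P (.tapp f τs tag) := by
  obtain ⟨ftag, ns, atoms, rfl, -⟩ := isVal_inv hfv
  obtain ⟨-, ht, -, -⟩ := hf.arr_arr_inv
  rw [RedLock, Expr.erase_tapp, Expr.erase_arr]
  -- A single operator among the atoms blocks both rules, which need every atom to be an
  -- abstraction. An empty array is not blocked.
  by_cases hop : ∃ o, Atom.op o ∈ atoms
  · obtain ⟨o, ho⟩ := hop
    refine .inr ⟨?_, ?_⟩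
    · rintro ⟨e', h⟩
      cases h
      simp at ho
    · rintro ⟨e', h⟩
      have ho' : EAtom.op o ∈ atoms.map Atom.erase := List.mem_map_of_mem (f := Atom.erase) ho
      generalize atoms.map Atom.erase = x at h ho'
      cases h
      simp at ho'
  · obtain ⟨bs, -, rfl⟩ : ∃ bs : List (Expr S), (∀ b ∈ bs, True) ∧ bs.map (.tlam ks) = atoms := by
      refine exists_map_eq fun a ha => ?_
      rcases (ht a ha).of_univ with ⟨body, rfl⟩ | ⟨o, rfl⟩
      exacts [⟨body, trivial, rfl⟩, (hop ⟨o, ha⟩).elim]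
    -- The rule allows each abstraction its own kinds; here they are all `ks`.
    have h := Red.tbeta (δ := P.delta) (ftag := ftag) (ns := ns) (τs := τs) (tag := tag)
      (bs := bs.map fun b => (ks, b)) (by simp [hl])
    simp only [List.map_map, Function.comp_def] at h
    refine .inl ⟨_, h, ?_⟩
    have h' := ERed.ibeta (δ := P.edelta) (ns := ns) (ιs := τs.map Ty.erase₀) (ι' := tag.erase₀)
      (bs := bs.map fun b => b.eraseIn (liftR ks.length fun k => 2 * k)
        (fun k => 2 * k + 1 + ks.length))
    convert h' using 1
    · simp [Atom.erase, Atom.eraseIn, hl]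
    · rw [Expr.erase_frame]
      simp [Expr.erase_subst_instT, hl]

theorem redLock_iapp (P : Prims S) {f : Expr S} {ιs : List Idx} {tag τ : Ty S.BaseTy}
    {γs : List Srt} {ιf : Idx} (hf : HasTy [] [] [] f (.arr (.pi γs τ) ιf))
    (hl : γs.length = ιs.length) (hfv : IsVal f) : RedLock P (.iapp f ιs tag) := by
  obtain ⟨ftag, ns, atoms, rfl, -⟩ := isVal_inv hfv
  obtain ⟨-, ht, -, -⟩ := hf.arr_arr_inv
  rw [RedLock, Expr.erase_iapp, Expr.erase_arr]
  by_cases hop : ∃ o, Atom.op o ∈ atoms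
  · obtain ⟨o, ho⟩ := hop
    refine .inr ⟨?_, ?_⟩
    · rintro ⟨e', h⟩
      cases h
      simp at ho
    · rintro ⟨e', h⟩
      have ho' : EAtom.op o ∈ atoms.map Atom.erase := List.mem_map_of_mem (f := Atom.erase) ho
      generalize atoms.map Atom.erase = x at h ho'
      cases h
      simp at ho'
  · obtain ⟨bs, -, rfl⟩ : ∃ bs : List (Expr S), (∀ b ∈ bs, True) ∧ bs.map (.ilam γs) = atoms := by
      refine exists_map_eq fun a ha => ?_
      rcases (ht a ha).of_pi with ⟨body, rfl⟩ | ⟨o, rfl⟩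
      exacts [⟨body, trivial, rfl⟩, (hop ⟨o, ha⟩).elim]
    have h := Red.ibeta (δ := P.delta) (ftag := ftag) (ns := ns) (ιs := ιs) (tag := tag)
      (bs := bs.map fun b => (γs, b)) (by simp [hl])
    simp only [List.map_map, Function.comp_def] at h
    refine .inl ⟨_, h, ?_⟩
    have h' := ERed.ibeta (δ := P.edelta) (ns := ns) (ιs := ιs.map Idx.erase) (ι' := tag.erase₀)
      (bs := bs.map fun b => b.eraseIn (fun k => 2 * k + γs.length)
        (liftR γs.length fun k => 2 * k + 1))
    convert h' using 1
    · simp [Atom.erase, Atom.eraseIn, hl]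
    · rw [Expr.erase_frame]
      simp [Expr.erase_subst_instI, hl]

theorem redLock_unbox (P : Prims S) {e body : Expr S} {tag τ τ' : Ty S.BaseTy} {γs : List Srt}
    {ιs ι : Idx} (he : HasTy [] [] [] e (.arr (.sigma γs τ) ιs)) (htag : TEqv [] tag (.arr τ' ι))
    (hv : IsVal e) : RedLock P (.unbox γs.length e body tag) := by
  obtain ⟨ftag, ns, atoms, rfl, hav⟩ := isVal_inv hv
  obtain ⟨-, ht, -, -⟩ := he.arr_arr_inv
  obtain ⟨τt, ιt, rfl, -, -⟩ := htag.exists_arr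
  rw [RedLock, Expr.erase_unbox, Expr.erase_arr]
  by_cases hop : ∃ o, Atom.op o ∈ atoms
  · obtain ⟨o, ho⟩ := hop
    refine .inr ⟨?_, ?_⟩
    · rintro ⟨e', h⟩
      cases h
      simp at ho
    · rintro ⟨e', h⟩
      have ho' : EAtom.op o ∈ atoms.map Atom.erase := List.mem_map_of_mem (f := Atom.erase) ho
      generalize atoms.map Atom.erase = x at h ho'
      cases h
      simp at ho'
  · obtain ⟨bs, hbs, rfl⟩ : ∃ bs : List (List Idx × Expr S × Ty S.BaseTy),
        (∀ b ∈ bs, b.1.length = γs.length ∧ IsVal b.2.1) ∧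
        bs.map (fun b => .box b.1 b.2.1 b.2.2) = atoms := by
      refine exists_map_eq fun a ha => ?_
      rcases (ht a ha).of_sigma with ⟨ιs, e, τ', rfl, hl⟩ | ⟨o, rfl⟩
      · cases hav _ ha with
        | box hv => exact ⟨(ιs, e, τ'), ⟨hl, hv⟩, rfl⟩
      · exact (hop ⟨o, ha⟩).elim
    refine .inl ⟨_, .unbox hbs, ?_⟩
    have h' := ERed.unbox (δ := P.edelta) (ns := ns) (n := γs.length) (ι := ιt.erase)
      (body := body.eraseIn (fun k => 2 * k + γs.length) (liftR γs.length fun k => 2 * k + 1))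
      (bs := bs.map fun b => (b.1.map Idx.erase, b.2.1.erase))
      (List.forall_mem_map.2 fun b hb =>
        ⟨by simpa using (hbs b hb).1, Expr.isVal_erase.2 (hbs b hb).2⟩)
    convert h' using 1
    · simp [Atom.erase_box, Ty.erase₀, Ty.erase, Idx.erase]
    · rw [Expr.erase_frame, Ty.erase₀, Ty.erase, Idx.rename]
      simp only [Idx.renames, Idx.rename_lits, List.map_map]
      congr 1
      refine List.map_congr_left fun b hb => ?_
      simp only [Function.comp_apply]
      -- The erasure lemma numbers variables past the length of the box's index list, the erased
      -- body past `γs.length`; the typing of the box makes these equal.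
      rw [Expr.erase_subst_instI_instE, (hbs b hb).1]

/-! ## Lockstep -/

/-- The conclusion of the lockstep lemma. -/
abbrev Lockstep (P : Prims S) (e : Expr S) : Prop :=
  Lock IsVal (Step P.delta) EIsVal (EStep P.edelta) Expr.erase e

/-- The lockstep property of the contents of an atom. -/
abbrev AtomLockstep (P : Prims S) (a : Atom S) : Prop :=
  Lock IsAVal (AStep P.delta) EIsAVal (EAStep P.edelta) Atom.erase a

theorem Lockstep.list {P : Prims S} {es : List (Expr S)} (h : ∀ e ∈ es, Lockstep P e) :
    Lock (fun l => ∀ x ∈ l, IsVal x) (ListStep IsVal (Step P.delta)) (fun l => ∀ x ∈ l, EIsVal x)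
      (ListStep EIsVal (EStep P.edelta)) (List.map Expr.erase) es :=
  Lock.list (fun _ _ => IsVal.not_step _ _) (fun _ _ => EIsVal.not_step _ _) h

theorem AtomLockstep.of_isAVal {P : Prims S} {a : Atom S} (h : IsAVal a) : AtomLockstep P a :=
  .inl ⟨h, Atom.isAVal_erase.2 h⟩

theorem AtomLockstep.box {P : Prims S} {ιs : List Idx} {e : Expr S} {τ : Ty S.BaseTy}
    (h : Lockstep P e) : AtomLockstep P (.box ιs e τ) := by
  rcases h with ⟨h, -⟩ | ⟨e', h, h'⟩ | ⟨⟨h₁, h₂⟩, h₁', h₂'⟩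
  · exact .of_isAVal (.box h)
  · exact .inr (.inl ⟨_, .box h, by rw [Atom.erase_box, Atom.erase_box]; exact .box h'⟩)
  · rw [AtomLockstep, Lock, Atom.erase_box]
    refine .inr (.inr ⟨⟨?_, ?_⟩, ?_, ?_⟩)
    · rintro (_ | _ | _ | _ | _ | h)
      exact h₁ h
    · rintro ⟨_, ⟨h⟩⟩
      exact h₂ ⟨_, h⟩
    · rintro (_ | _ | _ | _ | h)
      exact h₁' h
    · rintro ⟨_, ⟨h⟩⟩
      exact h₂' ⟨_, h⟩

theorem Lockstep.arr {P : Prims S} {tag : Ty S.BaseTy} {ns : List ℕ} {atoms : List (Atom S)}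
    (h : ∀ a ∈ atoms, AtomLockstep P a) : Lockstep P (.arr tag ns atoms) := by
  rw [Lockstep, Lock, Expr.erase_arr]
  rcases Lock.list (fun _ _ => IsAVal.not_step _ _) (fun _ _ => EIsAVal.not_step _ _) h with
    ⟨h, h'⟩ | ⟨atoms', h, h'⟩ | ⟨⟨h₁, h₂⟩, h₁', h₂'⟩
  · exact .inl ⟨.arr h, .arr h'⟩
  · refine .inr (.inl ⟨_, Step.arr_iff.2 ⟨atoms', rfl, h⟩, ?_⟩)
    rw [Expr.erase_arr]
    exact EStep.arr_iff.2 ⟨_, rfl, h'⟩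
  · refine .inr (.inr ⟨⟨fun h => h₁ (Expr.isVal_arr.1 h), ?_⟩,
      fun h => h₁' (EExpr.isVal_arr.1 h), ?_⟩)
    · rintro ⟨e', h⟩
      obtain ⟨_, -, h⟩ := Step.arr_iff.1 h
      exact h₂ ⟨_, h⟩
    · rintro ⟨e', h⟩
      obtain ⟨_, -, h⟩ := EStep.arr_iff.1 h
      exact h₂' ⟨_, h⟩

theorem Lockstep.frame {P : Prims S} {tag : Ty S.BaseTy} {ns : List ℕ} {cells : List (Expr S)}
    (h : ∀ e ∈ cells, Lockstep P e)
    (hred : (∀ e ∈ cells, IsVal e) → ∃ e', Red P.delta (.frame tag ns cells) e' ∧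
      ERed P.edelta (Expr.frame tag ns cells).erase e'.erase) :
    Lockstep P (.frame tag ns cells) := by
  rw [Lockstep, Lock]
  rcases Lockstep.list h with ⟨h, -⟩ | ⟨cells', h, h'⟩ | ⟨⟨h₁, h₂⟩, h₁', h₂'⟩
  · obtain ⟨e', h, h'⟩ := hred h
    exact .inr (.inl ⟨e', .red h, .red h'⟩)
  · refine .inr (.inl ⟨_, Step.frame h, ?_⟩)
    rw [Expr.erase_frame, Expr.erase_frame]
    exact EStep.frame h'
  · rw [Expr.erase_frame]
    refine .inr (.inr ⟨⟨nofun, ?_⟩, nofun, ?_⟩)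
    · rintro ⟨e', h⟩
      exact h.frame_inv.elim h₁ h₂
    · rintro ⟨e', h⟩
      exact h.frame_inv.elim h₁' h₂'

/-- The redex hypothesis is used only when function and arguments are all values. Otherwise the
first non-value decides, and in the stuck case inversion shows that a step would have to come from
that subterm. -/
theorem Lockstep.app {P : Prims S} {f : Expr S} {ins : List (Ty S.BaseTy)} {out tag : Ty S.BaseTy}
    {ι : Idx} {args : List (Expr S)} (hf : Lockstep P f) (ha : ∀ e ∈ args, Lockstep P e)
    (hred : IsVal f → (∀ e ∈ args, IsVal e) → RedLock P (.app f ins out ι args tag)) :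
    Lockstep P (.app f ins out ι args tag) := by
  rw [RedLock, Expr.erase_app] at hred
  rw [Lockstep, Lock, Expr.erase_app]
  rcases hf with ⟨hf, hf'⟩ | ⟨f', h, h'⟩ | ⟨⟨h₁, h₂⟩, h₁', h₂'⟩
  · have hn := fun e' => IsVal.not_step (δ := P.delta) _ e' hf
    have hn' := fun e' => EIsVal.not_step (δ := P.edelta) _ e' hf'
    rcases Lockstep.list ha with ⟨h, ha'⟩ | ⟨args', h, h'⟩ | ⟨⟨h₁, h₂⟩, h₁', h₂'⟩
    · rcases hred hf h with ⟨e', h, h'⟩ | ⟨h₁, h₂⟩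
      · exact .inr (.inl ⟨e', .red h, .red h'⟩)
      · refine .inr (.inr ⟨⟨nofun, ?_⟩, nofun, ?_⟩)
        · rintro ⟨e', hs⟩
          rcases hs.app_inv with ⟨_, hs⟩ | ⟨-, hs⟩ | ⟨-, -, hs⟩
          exacts [hn _ hs, ListStep.not_of_val (fun _ _ => IsVal.not_step _ _) h hs, h₁ hs]
        · rintro ⟨e', hs⟩
          rcases hs.app_inv with ⟨_, hs⟩ | ⟨-, hs⟩ | ⟨-, -, hs⟩
          exacts [hn' _ hs, ListStep.not_of_val (fun _ _ => EIsVal.not_step _ _) ha' hs, h₂ hs]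
    · refine .inr (.inl ⟨_, Step.args hf h, ?_⟩)
      rw [Expr.erase_app]
      exact EStep.args hf' h'
    · refine .inr (.inr ⟨⟨nofun, ?_⟩, nofun, ?_⟩)
      · rintro ⟨e', hs⟩
        rcases hs.app_inv with ⟨_, hs⟩ | ⟨-, hs⟩ | ⟨-, hs, -⟩
        exacts [hn _ hs, h₂ hs, h₁ hs]
      · rintro ⟨e', hs⟩
        rcases hs.app_inv with ⟨_, hs⟩ | ⟨-, hs⟩ | ⟨-, hs, -⟩
        exacts [hn' _ hs, h₂' hs, h₁' hs]
  · refine .inr (.inl ⟨_, .fn h, ?_⟩)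
    rw [Expr.erase_app]
    exact .fn h'
  · refine .inr (.inr ⟨⟨nofun, ?_⟩, nofun, ?_⟩)
    · rintro ⟨e', hs⟩
      rcases hs.app_inv with hs | ⟨hs, -⟩ | ⟨hs, -⟩
      exacts [h₂ hs, h₁ hs, h₁ hs]
    · rintro ⟨e', hs⟩
      rcases hs.app_inv with hs | ⟨hs, -⟩ | ⟨hs, -⟩
      exacts [h₂' hs, h₁' hs, h₁' hs]

/-- The erased term is an index application, so steps on that side are built and inverted by the
rules for `iapp`. -/
theorem Lockstep.tapp {P : Prims S} {f : Expr S} {τs : List (Ty S.BaseTy)} {tag : Ty S.BaseTy}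
    (hf : Lockstep P f) (hred : IsVal f → RedLock P (.tapp f τs tag)) :
    Lockstep P (.tapp f τs tag) := by
  rw [RedLock, Expr.erase_tapp] at hred
  rw [Lockstep, Lock, Expr.erase_tapp]
  rcases hf with ⟨hf, hf'⟩ | ⟨f', h, h'⟩ | ⟨⟨h₁, h₂⟩, h₁', h₂'⟩
  · rcases hred hf with ⟨e', h, h'⟩ | ⟨h₁, h₂⟩
    · exact .inr (.inl ⟨e', .red h, .red h'⟩)
    · refine .inr (.inr ⟨⟨nofun, ?_⟩, nofun, ?_⟩)
      · rintro ⟨e', hs⟩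
        exact hs.tapp_inv.elim (fun ⟨_, hs⟩ => hf.not_step _ _ hs) fun hs => h₁ hs.2
      · rintro ⟨e', hs⟩
        exact hs.iapp_inv.elim (fun ⟨_, hs⟩ => hf'.not_step _ _ hs) fun hs => h₂ hs.2
  · exact .inr (.inl ⟨_, .tapp h, .iapp h'⟩)
  · refine .inr (.inr ⟨⟨nofun, ?_⟩, nofun, ?_⟩)
    · rintro ⟨e', hs⟩
      exact hs.tapp_inv.elim h₂ fun hs => h₁ hs.1
    · rintro ⟨e', hs⟩
      exact hs.iapp_inv.elim h₂' fun hs => h₁' hs.1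

theorem Lockstep.iapp {P : Prims S} {f : Expr S} {ιs : List Idx} {tag : Ty S.BaseTy}
    (hf : Lockstep P f) (hred : IsVal f → RedLock P (.iapp f ιs tag)) :
    Lockstep P (.iapp f ιs tag) := by
  rw [RedLock, Expr.erase_iapp] at hred
  rw [Lockstep, Lock, Expr.erase_iapp]
  rcases hf with ⟨hf, hf'⟩ | ⟨f', h, h'⟩ | ⟨⟨h₁, h₂⟩, h₁', h₂'⟩
  · rcases hred hf with ⟨e', h, h'⟩ | ⟨h₁, h₂⟩
    · exact .inr (.inl ⟨e', .red h, .red h'⟩)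
    · refine .inr (.inr ⟨⟨nofun, ?_⟩, nofun, ?_⟩)
      · rintro ⟨e', hs⟩
        exact hs.iapp_inv.elim (fun ⟨_, hs⟩ => hf.not_step _ _ hs) fun hs => h₁ hs.2
      · rintro ⟨e', hs⟩
        exact hs.iapp_inv.elim (fun ⟨_, hs⟩ => hf'.not_step _ _ hs) fun hs => h₂ hs.2
  · refine .inr (.inl ⟨_, .iapp h, ?_⟩)
    rw [Expr.erase_iapp]
    exact .iapp h'
  · refine .inr (.inr ⟨⟨nofun, ?_⟩, nofun, ?_⟩)
    · rintro ⟨e', hs⟩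
      exact hs.iapp_inv.elim h₂ fun hs => h₁ hs.1
    · rintro ⟨e', hs⟩
      exact hs.iapp_inv.elim h₂' fun hs => h₁' hs.1

theorem Lockstep.unbox {P : Prims S} {e body : Expr S} {n : ℕ} {tag : Ty S.BaseTy}
    (he : Lockstep P e) (hred : IsVal e → RedLock P (.unbox n e body tag)) :
    Lockstep P (.unbox n e body tag) := by
  rw [RedLock, Expr.erase_unbox] at hred
  rw [Lockstep, Lock, Expr.erase_unbox]
  rcases he with ⟨hf, hf'⟩ | ⟨f', h, h'⟩ | ⟨⟨h₁, h₂⟩, h₁', h₂'⟩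
  · rcases hred hf with ⟨e', h, h'⟩ | ⟨h₁, h₂⟩
    · exact .inr (.inl ⟨e', .red h, .red h'⟩)
    · refine .inr (.inr ⟨⟨nofun, ?_⟩, nofun, ?_⟩)
      · rintro ⟨e', hs⟩
        exact hs.unbox_inv.elim (fun ⟨_, hs⟩ => hf.not_step _ _ hs) fun hs => h₁ hs.2
      · rintro ⟨e', hs⟩
        exact hs.unbox_inv.elim (fun ⟨_, hs⟩ => hf'.not_step _ _ hs) fun hs => h₂ hs.2
  · exact .inr (.inl ⟨_, .unbox h, .unbox h'⟩)
  · refine .inr (.inr ⟨⟨nofun, ?_⟩, nofun, ?_⟩)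
    · rintro ⟨e', hs⟩
      exact hs.unbox_inv.elim h₂ fun hs => h₁ hs.1
    · rintro ⟨e', hs⟩
      exact hs.unbox_inv.elim h₂' fun hs => h₁' hs.1

/-- Closed well-typed expressions and their erasures evaluate in lockstep. -/
theorem HasTy.lockstep (P : Prims S) {e : Expr S} {τ : Ty S.BaseTy} (h : HasTy [] [] [] e τ) :
    Lockstep P e := by
  -- The motives carry equations that make the environments empty, as the recursor needs variable
  -- environments. The induction hypotheses for bodies of abstractions and of unboxings are not
  -- needed: these are never evaluated in place.
  refine HasTy.rec
    (motive_1 := fun Θ Δ Γ e _ _ => Θ = [] → Δ = [] → Γ = [] → Lockstep P e)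
    (motive_2 := fun Θ Δ Γ a _ _ => Θ = [] → Δ = [] → Γ = [] → AtomLockstep P a)
    ?eqv ?var ?arr ?frame ?app ?tapp ?iapp ?unbox ?aeqv ?base ?op ?lam ?tlam ?ilam ?box
    h rfl rfl rfl
  case eqv => exact fun _ _ ih => ih
  case var =>
    rintro Θ Δ Γ x τ h rfl rfl rfl
    simp at h
  case arr =>
    rintro Θ Δ Γ tag ns atoms τ h _ _ _ ih rfl rfl rfl
    exact .arr fun a ha => ih a ha rfl rfl rfl
  case frame =>
    rintro Θ Δ Γ tag ns cells τ ι h hk _ ht ih rfl rfl rfl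
    exact .frame (fun e he => ih e he rfl rfl rfl) (redLock_frame P h hk ht)
  case app =>
    rintro Θ Δ Γ f args tag τo ιo ιf ιp ps hf hl ha hm ht ihf iha rfl rfl rfl
    have ha' : List.Forall₂ (fun a p => HasTy [] [] [] a p.argTy) args ps :=
      List.forall₂_iff_zip.2 ⟨hl, fun h => ha _ h⟩
    refine .app (ihf rfl rfl rfl) (fun e he => ?_) (redLock_app P hf ha' hm ht)
    obtain ⟨i, hi, rfl⟩ := List.mem_iff_getElem.1 he
    exact iha (args[i], ps[i]) (getElem_mem_zip _ _) rfl rfl rfl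
  case tapp =>
    rintro Θ Δ Γ f τs tag ks τ ι ιf hf hτs ht ih rfl rfl rfl
    exact .tapp (ih rfl rfl rfl) (redLock_tapp P hf hτs.length_eq.symm)
  case iapp =>
    rintro Θ Δ Γ f ιs tag γs τ ι ιf hf hιs ht ih rfl rfl rfl
    exact .iapp (ih rfl rfl rfl) (redLock_iapp P hf hιs.length_eq.symm)
  case unbox =>
    rintro Θ Δ Γ e body tag γs τs ιs τ ι he _ _ ht ih _ rfl rfl rfl
    exact .unbox (ih rfl rfl rfl) (redLock_unbox P he ht)
  case aeqv => exact fun _ _ ih => ih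
  case base => exact fun _ _ _ => .of_isAVal .base
  case op => exact fun _ _ _ => .of_isAVal .op
  case lam => exact fun _ _ _ _ _ _ => .of_isAVal .lam
  case tlam => exact fun _ _ _ _ _ => .of_isAVal .tlam
  case ilam => exact fun _ _ _ _ _ => .of_isAVal .ilam
  case box =>
    rintro Θ Δ Γ ιs e γs τ _ _ _ ih rfl rfl rfl
    exact .box (ih rfl rfl rfl)

end Lockstep

end Remora

theorem mainTheorem5 (S : Remora.Sig.{u}) (P : Remora.Prims S) (e : Remora.Expr S)
    (τ : Remora.Ty S.BaseTy) (he : Remora.HasTy [] [] [] e τ) :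
    (Remora.IsVal e ∧ Remora.EIsVal e.erase) ∨
    (∃ e', Remora.Step P.delta e e' ∧ Remora.EStep P.edelta e.erase e'.erase) ∨
    (Remora.Stuck P.delta e ∧ Remora.EStuck P.edelta e.erase) :=
  he.lockstep P
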